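/- Throughout, $\log$ is the logarithm to base $2$ and $[n]=\{1,\dots,n\}$. **The hash family.** For positive integers $n,m,t,\kappa$, a random hash $h:[m]\to[n]\cup\{-1\}$ is drawn from $\mathcal H^{n,m,t,\kappa}$ as follows. Sample mutually independent random functions $h_1,\dots,h_t:[m]\to[n]\cup\{0\}$ such that every $h_i$ is $\kappa$-wise independent (its values at any at most $\kappa$ points are independent) and, for all $j\in[m]$ and $v\in[n]$, $\Pr[h_i(j)=0]=\frac12$ and $\Pr[h_i(j)=v]=\frac1{2n}$. Put $h(j)=h_q(j)$ for the smallest $q\le t$ with $h_q(j)\ne 0$, and $h(j)=-1$ if there is no such $q$. (Statements about $\mathcal H^{n,m,t,\kappa}$ hold for every choice of such distributions of the $h_i$.) **Reachability.** For $a:[n]\to[m]$ and $h:[m]\to[n]\cup\{-1\}$ let $G_{a,h}$ be the digraph on $[n]$ with an edge $(x,h(a_x))$ for each $x$ with $h(a_x)\neq-1$, and let $\mathsf{Out}_{a,h}(x)$ be the set of vertices reachable from $x$ (including $x$). **Theorem.** Let $c\ge1$ be an integer. 1. There are constants $D_c\ge1$, $\delta_c>0$ and $n_c$, depending only on $c$,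 such that the following holds for all $n\ge n_c$ and all $m\ge n$. Let $t=\frac12\log n-D_c$ and $\kappa=5c\log n$, each rounded up or down to an integer. For every injective $a:[n]\to[m]$ and all vertices $1\le u_1<\dots<u_c\le n$, $$\Pr_{h\sim\mathcal H^{n,m,t,\kappa},\;x\sim[n]}\bigl[u_1,\dots,u_c\in\mathsf{Out}_{a,h}(x)\bigr]\;\ge\;\delta_c\,n^{-c/2},$$ where $x$ is uniform in $[n]$ and independent of $h$. 2. Consequently, there are constants $C_c,\delta'_c>0$, depending only on $c$, such that for all $m\ge n\ge2$ there are an integer $0\le r\le C_c\log^2(n)\log(m)$ and a map $G:\{0,1\}^r\to\{h\mid h:[m]\to[n]\}$ such that the hash family sampled as $h=G(s)$ with $s$ uniform in $\{0,1\}^r$ is $c$-connecting: for every injective $a:[n]\to[m]$ and all $1\le u_1<\dots<u_c\le n$, $$\Pr_{s,\;x\sim[n]}\bigl[u_1,\dots,u_c\in\mathsf{Out}_{a,G(s)}(x)\bigr]\;\ge\;\delta'_c\,n^{-c/2}.$$ -/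

import Mathlib

/-- The probability of the event `E` under the distribution `p`. -/
noncomputable def pr {α : Type*} (p : PMF α) (E : Set α) : ℝ :=
  (p.toOuterMeasure E).toReal

/-- `Q` is a possible joint law of the level hashes `h_1, …, h_t : [m] → [n] ∪ {0}`
(the extra value `0` is `none`): the `h_i` are mutually independent, every `h_i j` is `0` with
probability `1/2` and equals each `v ∈ [n]` with probability `1/(2n)`, and every `h_i` is
`κ`-wise independent. -/
structure IsLevelLaw (n m t κ : ℕ) (Q : PMF (Fin t → Fin m → Option (Fin n))) : Prop where
  indep : ∀ g : Fin t → Fin m → Option (Fin n),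
    pr Q {h | ∀ i, h i = g i} = ∏ i, pr Q {h | h i = g i}
  marginal_zero : ∀ (i : Fin t) (j : Fin m), pr Q {h | h i j = none} = 1 / 2
  marginal_vertex : ∀ (i : Fin t) (j : Fin m) (v : Fin n),
    pr Q {h | h i j = some v} = 1 / (2 * (n : ℝ))
  kwise : ∀ (i : Fin t) (s : Finset (Fin m)), s.card ≤ κ → ∀ y : Fin m → Option (Fin n),
    pr Q {h | ∀ j ∈ s, h i j = y j} = ∏ j ∈ s, pr Q {h | h i j = y j}

/-- The final hash `[m] → [n] ∪ {-1}` (the extra value `-1` is `none`): the value at `j` is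
`h_q j` for the smallest `q` with `h_q j ≠ 0`, and `-1` if there is no such `q`. -/
def finalHash {n m t : ℕ} (h : Fin t → Fin m → Option (Fin n)) (j : Fin m) : Option (Fin n) :=
  (List.finRange t).findSome? fun q => h q j

/-- The law of the final hash: the family `H^{n,m,t,κ}` when `IsLevelLaw n m t κ Q`. -/
noncomputable def finalLaw {n m t : ℕ} (Q : PMF (Fin t → Fin m → Option (Fin n))) :
    PMF (Fin m → Option (Fin n)) :=
  Q.map finalHash

/-- The vertices reachable from `x` in the digraph on `[n]` that has an edge from `x` to `y`
whenever `h (a x) = y` (and no edge out of `x` if `h (a x) = -1`). -/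
def outSet {n m : ℕ} (a : Fin n → Fin m) (h : Fin m → Option (Fin n)) (x : Fin n) :
    Set (Fin n) :=
  {y | Relation.ReflTransGen (fun v w => h (a v) = some w) x y}

/-- The probability, over `h` drawn from `H` and an independent uniform `x ∈ [n]`, that all
vertices `u i` are reachable from `x`. -/
noncomputable def reachProb {n m c : ℕ} (H : PMF (Fin m → Option (Fin n)))
    (a : Fin n → Fin m) (u : Fin c → Fin n) : ℝ :=
  (∑ x : Fin n, pr H {h | ∀ i, u i ∈ outSet a h x}) / n

/-- The `c`-connecting property of a distribution over hashes, with the constant `δ`. -/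
def IsConnecting {n m : ℕ} (c : ℕ) (δ : ℝ) (H : PMF (Fin m → Option (Fin n))) : Prop :=
  ∀ a : Fin n → Fin m, Function.Injective a → ∀ u : Fin c → Fin n, StrictMono u →
    δ * (n : ℝ) ^ (-(c : ℝ) / 2) ≤ reachProb H a u

/-- The family of total hashes `[m] → [n]` sampled by applying `G` to `r` uniform random bits. -/
noncomputable def seedFamily {n m r : ℕ} (G : (Fin r → Bool) → Fin m → Fin n) :
    PMF (Fin m → Option (Fin n)) :=
  (PMF.uniformOfFintype (Fin r → Bool)).map fun s j => some (G s j)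

/-! Reveal the levels one at a time. After `i` levels every walk runs until its sink, a vertex on
which all levels so far gave `0`. A walk of the next level is a chain of such walks, its segments: a
segment ends at its sink, the new hash is queried there, and the walk jumps with probability 1/2 to
a uniform vertex or stops. As long as the queried sinks are distinct, the starts of the segments
behave like independent uniform vertices, and a walk has a geometric number of segments with mean 2.

Let `soloProb` be the probability that `c` uniform walks visit their targets and have distinct
sinks. It starts at `n^(-c)`. A target may be visited in any segment of its walk, so one level
multiplies it by about `2^c`. The losses are controlled by `badProb` (one more walk spoils the
event) and `collProb` (one more walk shares the sink of an otherwise unconstrained walk). These grow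
by at most `2·2^c` and `4·2^c` per level, up to error terms, so relative to `soloProb` the loss
after `i` levels is `O(4^i/n)`, apart from a truncation error. With `i` equal to `(log n)/2` minus a
constant this is small and `soloProb` is of order `n^(-c/2)`. On the last level one walk with `c`
segments collects all targets, at the cost of a factor `2^(-c)`.

Each walk is cut off at `K` segments per level. At most `K(c+2)` values of one level are then
involved, so `κ`-wise independence suffices, and `2^(-K) ≤ 1/n` makes the cutoff harmless. The core
is the exact expansion `IsKWise.sum_goodProb_step`, together with `goodProb_sub_le` and
`IsKWise.sum_collProb_step_le`; `solo_lower_bound` solves the recursion.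

For the second part, a fully independent instance of the family is sampled `2^r` times. An
exponential moment and a union bound over all pairs `(a, u)` show that some sample is connecting, so
`G` comes from the probabilistic method. -/

noncomputable section

namespace Connecting

open Function Filter

/-! ### Indicators. -/

/-- The real-valued indicator of a proposition. -/
def ind (p : Prop) : ℝ := by classical exact if p then 1 else 0

theorem ind_of {p : Prop} (h : p) : ind p = 1 := by simp [ind, h]

theorem ind_of_not {p : Prop} (h : ¬p) : ind p = 0 := by simp [ind, h]

theorem ind_nonneg (p : Prop) : 0 ≤ ind p := by
  by_cases h : p <;> simp [ind, h]

theorem ind_le_one (p : Prop) : ind p ≤ 1 := by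
  by_cases h : p <;> simp [ind, h]

theorem ind_and (p q : Prop) : ind (p ∧ q) = ind p * ind q := by
  by_cases hp : p <;> by_cases hq : q <;> simp [ind, hp, hq]

theorem ind_mono {p q : Prop} (h : p → q) : ind p ≤ ind q := by
  by_cases hp : p
  · rw [ind_of hp, ind_of (h hp)]
  · rw [ind_of_not hp]; exact ind_nonneg q

theorem ind_le_sum {X : Type*} [Fintype X] {p : Prop} {q : X → Prop} (h : p → ∃ x, q x) :
    ind p ≤ ∑ x, ind (q x) := by
  by_cases hp : p
  · obtain ⟨x, hx⟩ := h hp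
    rw [ind_of hp, ← ind_of hx]
    exact Finset.single_le_sum (f := fun x => ind (q x)) (fun i _ => ind_nonneg _)
      (Finset.mem_univ x)
  · rw [ind_of_not hp]; exact Finset.sum_nonneg fun i _ => ind_nonneg _

theorem ind_eq_sum {X : Type*} [Fintype X] {p : Prop} {q : X → Prop} (h : p ↔ ∃ x, q x)
    (hu : ∀ x y, q x → q y → x = y) : ind p = ∑ x, ind (q x) := by
  by_cases hp : p
  · obtain ⟨x, hx⟩ := h.1 hp
    rw [ind_of hp, Finset.sum_eq_single x, ind_of hx]
    · intro y _ hy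
      exact ind_of_not fun hq => hy (hu y x hq hx)
    · simp
  · rw [ind_of_not hp, Finset.sum_eq_zero]
    intro y _
    exact ind_of_not fun hq => hp (h.2 ⟨y, hq⟩)

theorem sum_ind_eq {X : Type*} [Fintype X] (x : X) : ∑ y, ind (x = y) = 1 := by
  rw [← ind_of trivial]
  exact (ind_eq_sum (by simp) (by rintro a b rfl rfl; rfl)).symm

/-! ### Averages over independent uniform vertices. -/

section Average

variable {V : Type} [Fintype V]

/-- The average of `φ` over all tuples `I → V`. -/
def avg {I : Type} [Fintype I] [DecidableEq I] (φ : (I → V) → ℝ) : ℝ :=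
  (∑ z, φ z) / (Fintype.card V : ℝ) ^ Fintype.card I

variable {I J : Type} [Fintype I] [DecidableEq I] [Fintype J] [DecidableEq J]

theorem avg_mono {φ ψ : (I → V) → ℝ} (h : ∀ z, φ z ≤ ψ z) : avg φ ≤ avg ψ := by
  unfold avg
  gcongr
  exact h _

theorem avg_nonneg {φ : (I → V) → ℝ} (h : ∀ z, 0 ≤ φ z) : 0 ≤ avg φ :=
  div_nonneg (Finset.sum_nonneg fun z _ => h z) (by positivity)

theorem avg_add (φ ψ : (I → V) → ℝ) : avg (fun z => φ z + ψ z) = avg φ + avg ψ := by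
  simp only [avg, Finset.sum_add_distrib, add_div]

theorem avg_sub (φ ψ : (I → V) → ℝ) : avg (fun z => φ z - ψ z) = avg φ - avg ψ := by
  simp only [avg, Finset.sum_sub_distrib, sub_div]

theorem avg_sum {X : Type*} (s : Finset X) (φ : X → (I → V) → ℝ) :
    avg (fun z => ∑ x ∈ s, φ x z) = ∑ x ∈ s, avg (φ x) := by
  simp only [avg, Finset.sum_div]
  rw [Finset.sum_comm]

/-- Marginalization: each coordinate outside the range of `e` contributes a factor `card V`, which
the normalization cancels. -/
theorem avg_comp [Nonempty V] (e : J → I) (he : Injective e) (φ : (J → V) → ℝ) :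
    avg (fun z : I → V => φ (z ∘ e)) = avg φ := by
  classical
  let C := {i // i ∉ Set.range e}
  let E : J ⊕ C ≃ I :=
    ((Equiv.ofInjective e he).sumCongr (Equiv.refl C)).trans (Equiv.Set.sumCompl (Set.range e))
  have hE : ∀ j, E (Sum.inl j) = e j := fun j => rfl
  let T : (I → V) ≃ (J → V) × (C → V) :=
    (E.symm.arrowCongr (Equiv.refl V)).trans (Equiv.sumArrowEquivProdArrow J C V)
  have hT : ∀ z, (T z).1 = z ∘ e := fun z => by
    ext j; simp [T, Equiv.sumArrowEquivProdArrow, hE]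
  have h1 : ∑ z : I → V, φ (z ∘ e) = ∑ p : (J → V) × (C → V), φ p.1 :=
    Fintype.sum_equiv T _ _ fun z => by rw [hT]
  have hc : Fintype.card I = Fintype.card C + Fintype.card J := by
    rw [← Fintype.card_congr E, Fintype.card_sum, add_comm]
  have hV : (Fintype.card V : ℝ) ≠ 0 := by simp
  unfold avg
  rw [h1, Fintype.sum_prod_type, hc, pow_add]
  simp only [Finset.sum_const, Finset.card_univ, Fintype.card_fun, nsmul_eq_mul, Nat.cast_pow,
    ← Finset.mul_sum]
  rw [mul_div_mul_left _ _ (by positivity)]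

end Average

/-! ### Walks of one level and their coalescence. -/

/-- What the walks of one level look like from outside: where a walk ends (if it does so within
its budget), and which vertices it visits. -/
structure LevelState (V : Type) where
  sink : V → Option V
  visits : V → V → Prop
  coherent : ∀ {y y' u s s'}, visits y u → visits y' u → sink y = some s → sink y' = some s' →
    s = s'

/-- The state before the first level: all walks are trivial. -/
def LevelState.base (V : Type) : LevelState V where
  sink := some
  visits y u := y = u
  coherent := by rintro y y' u s s' rfl rfl h h'; simp_all

section Walk

variable {V : Type} (S : LevelState V) (g : V → Option V)

/-- The starting vertices of the segments of the walk from `y`. -/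
def traj (y : V) : ℕ → Option V
  | 0 => some y
  | k + 1 => (traj y k).bind fun z => (S.sink z).bind g

/-- The walk from `y` stops at `s` after exactly `l` jumps. -/
def EndsAt (y : V) (l : ℕ) (s : V) : Prop :=
  ∃ z, traj S g y l = some z ∧ S.sink z = some s ∧ g s = none

variable {S g}

theorem traj_add (y : V) (p k : ℕ) :
    traj S g y (p + k) = (traj S g y p).bind fun z => traj S g z k := by
  induction k with
  | zero => simp [traj]
  | succ k ih => rw [← add_assoc, traj, ih, Option.bind_assoc]; rfl

theorem EndsAt.traj_eq_none {y s : V} {l p : ℕ} (h : EndsAt S g y l s) (hp : l < p) :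
    traj S g y p = none := by
  obtain ⟨z, h1, h2, h3⟩ := h
  obtain ⟨k, rfl⟩ := Nat.exists_eq_add_of_lt hp
  rw [add_assoc, add_comm k, ← add_assoc, traj_add, traj, h1]
  simp [h2, h3]

theorem endsAt_shift {y z s : V} {p k : ℕ} (h : traj S g y p = some z) :
    EndsAt S g y (p + k) s ↔ EndsAt S g z k s := by
  unfold EndsAt
  rw [traj_add, h]
  rfl

theorem EndsAt.tail {y z s : V} {l p : ℕ} (h : EndsAt S g y l s) (hp : traj S g y p = some z) :
    p ≤ l ∧ EndsAt S g z (l - p) s := by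
  have hle : p ≤ l := by
    by_contra hlt
    rw [h.traj_eq_none (not_le.1 hlt)] at hp
    cases hp
  refine ⟨hle, (endsAt_shift hp).1 ?_⟩
  rwa [Nat.add_sub_cancel' hle]

theorem EndsAt.unique {y s s' : V} {l l' : ℕ} (h : EndsAt S g y l s) (h' : EndsAt S g y l' s') :
    l = l' ∧ s = s' := by
  have key : l = l' := by
    obtain ⟨z, hz, -⟩ := id h
    obtain ⟨z', hz', -⟩ := id h'
    exact le_antisymm (h'.tail hz).1 (h.tail hz').1
  subst key
  obtain ⟨z, h1, h2, -⟩ := h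
  obtain ⟨z', h1', h2', -⟩ := h'
  simp_all

theorem EndsAt.congr {z z' s : V} {k : ℕ} (hs : S.sink z = S.sink z') (h : EndsAt S g z k s) :
    EndsAt S g z' k s := by
  cases k with
  | zero =>
    obtain ⟨x, h1, h2, h3⟩ := h
    cases h1
    exact ⟨z', rfl, hs ▸ h2, h3⟩
  | succ k =>
    obtain ⟨x, h1, h2, h3⟩ := h
    refine ⟨x, ?_, h2, h3⟩
    rw [add_comm, traj_add] at h1 ⊢
    simpa [traj, hs] using h1

/-- The start of a segment influences the later walk only through its sink, so two walks with a
common sink coincide from there on. -/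
theorem EndsAt.merge {y y' z z' s s' : V} {l l' p p' : ℕ} (h : EndsAt S g y l s)
    (h' : EndsAt S g y' l' s') (hz : traj S g y p = some z) (hz' : traj S g y' p' = some z')
    (hs : S.sink z = S.sink z') : p ≤ l ∧ l' = p' + (l - p) ∧ s = s' := by
  obtain ⟨h1, h2⟩ := h.tail hz
  obtain ⟨h3, h4⟩ := h'.unique ((endsAt_shift hz').2 (h2.congr hs))
  exact ⟨h1, h3, h4.symm⟩

theorem EndsAt.exists_traj {y s : V} {l p : ℕ} (h : EndsAt S g y l s) (hp : p ≤ l) :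
    ∃ z a, traj S g y p = some z ∧ S.sink z = some a := by
  obtain ⟨k, rfl⟩ := Nat.exists_eq_add_of_le hp
  obtain ⟨x, h1, h2, h3⟩ := h
  rw [traj_add] at h1
  cases hz : traj S g y p with
  | none => simp [hz] at h1
  | some z =>
    refine ⟨z, ?_⟩
    rw [hz, Option.bind_some] at h1
    cases k with
    | zero => cases h1; exact ⟨s, rfl, h2⟩
    | succ k =>
      rw [add_comm, traj_add] at h1
      cases hz : S.sink z with
      | none => simp [traj, hz] at h1
      | some a => exact ⟨a, rfl, rfl⟩

variable (S g) in
/-- The state after one more level with hash `g`, where walks may consist of at most `K`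
segments. -/
def LevelState.step (K : ℕ) : LevelState V where
  sink y := by
    classical exact if h : ∃ s, ∃ l < K, EndsAt S g y l s then some h.choose else none
  visits y u := ∃ l < K, ∃ z, traj S g y l = some z ∧ S.visits z u
  coherent := by
    rintro y y' u s s' ⟨p, -, z, hz, hu⟩ ⟨p', -, z', hz', hu'⟩ hs hs'
    split_ifs at hs with h
    split_ifs at hs' with h'
    obtain ⟨l, -, hl⟩ := h.choose_spec
    obtain ⟨l', -, hl'⟩ := h'.choose_spec
    cases hs
    cases hs'
    -- The two segments that visit `u` have equal sinks by the coherence of `S`, and then the walks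
    -- merge.
    obtain ⟨w, a, hw, ha⟩ := hl.exists_traj (hl.tail hz).1
    obtain ⟨w', a', hw', ha'⟩ := hl'.exists_traj (hl'.tail hz').1
    obtain rfl : z = w := by simpa [hz] using hw
    obtain rfl : z' = w' := by simpa [hz'] using hw'
    have := S.coherent hu hu' ha ha'
    exact (hl.merge hl' hz hz' (by rw [ha, ha', this])).2.2

theorem step_sink_eq_some {K : ℕ} {y s : V} :
    (S.step g K).sink y = some s ↔ ∃ l < K, EndsAt S g y l s := by
  unfold LevelState.step
  constructor
  · intro hs
    dsimp only at hs
    split_ifs at hs with h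
    cases hs
    exact h.choose_spec
  · rintro ⟨l, hl, h⟩
    have hex : ∃ s, ∃ l < K, EndsAt S g y l s := ⟨s, l, hl, h⟩
    dsimp only
    rw [dif_pos hex]
    obtain ⟨l', -, h'⟩ := hex.choose_spec
    rw [(h'.unique h).2]

end Walk

/-! ### Exact expansion of one level over patterns of segments. -/

section Expansion

variable {V : Type} {c : ℕ} {I : Type}

/-- The walks from the vertices `z i` have pairwise distinct ends, and the walk number `e j`
visits `u j`. -/
def Good (S : LevelState V) (u : Fin c → V) (e : Fin c → I) (z : I → V) : Prop :=
  (∀ j, S.visits (z (e j)) (u j)) ∧ ∃ a : I → V, Injective a ∧ ∀ i, S.sink (z i) = some (a i)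

/-- The probability of `Good` for independent uniform starting vertices. -/
def goodProb [Fintype V] [Fintype I] [DecidableEq I] (S : LevelState V) (u : Fin c → V)
    (e : Fin c → I) : ℝ :=
  avg fun z => ind (Good S u e z)

/-- The index set of the segments of walks number `i` with `L i` jumps. -/
abbrev RunIndex {W : Type} {K : ℕ} (L : W → Fin K) : Type := Σ i, Fin ((L i : ℕ) + 1)

variable {W : Type} {K : ℕ}

/-- The start of the segment after the segment `x`, if there is one. -/
def nextStart {L : W → Fin K} (z : RunIndex L → V) (x : RunIndex L) : Option V :=
  if h : (x.2 : ℕ) + 1 < (L x.1 : ℕ) + 1 then some (z ⟨x.1, ⟨x.2 + 1, h⟩⟩) else none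

/-- The hash `g` makes the walks consist of the segments that start at the vertices `z x`. -/
def Occurs (S : LevelState V) (g : V → Option V) {L : W → Fin K} (z : RunIndex L → V) : Prop :=
  ∀ x a, S.sink (z x) = some a → g a = nextStart z x

variable {S : LevelState V} {g : V → Option V} {u : Fin c → V}

theorem Occurs.traj {L : W → Fin K} {z : RunIndex L → V} {a : RunIndex L → V}
    (ho : Occurs S g z) (ha : ∀ x, S.sink (z x) = some (a x)) (i : W) (p : ℕ)
    (hp : p < (L i : ℕ) + 1) : traj S g (z ⟨i, 0⟩) p = some (z ⟨i, ⟨p, hp⟩⟩) := by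
  induction p with
  | zero => rfl
  | succ p ih =>
    rw [Connecting.traj, ih (by omega), Option.bind_some, ha, Option.bind_some,
      ho _ _ (ha _), nextStart, dif_pos hp]

theorem Occurs.endsAt {L : W → Fin K} {z : RunIndex L → V} {a : RunIndex L → V}
    (ho : Occurs S g z) (ha : ∀ x, S.sink (z x) = some (a x)) (i : W) :
    EndsAt S g (z ⟨i, 0⟩) (L i) (a ⟨i, Fin.last _⟩) := by
  refine ⟨_, ho.traj ha i _ (Nat.lt_succ_self _), ha _, ?_⟩
  have := ho ⟨i, Fin.last _⟩ _ (ha _)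
  rwa [nextStart, dif_neg (by simp)] at this

/-- The queries are distinct because a repeated query forces a common end, hence the same walk, and
then the same distance to the end, hence the same segment. -/
theorem exists_occurs {y : W → V} {L : W → Fin K} {s : W → V} (hs : Injective s)
    (hL : ∀ i, EndsAt S g (y i) (L i) (s i)) :
    ∃ z a : RunIndex L → V, (fun i => z ⟨i, 0⟩) = y ∧
      (∀ x, Connecting.traj S g (y x.1) x.2 = some (z x)) ∧
      (∀ x, S.sink (z x) = some (a x)) ∧ Injective a ∧ Occurs S g z := by
  have hex : ∀ x : RunIndex L, ∃ z a, Connecting.traj S g (y x.1) x.2 = some z ∧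
      S.sink z = some a := fun x => (hL x.1).exists_traj (Nat.lt_succ_iff.1 x.2.2)
  choose z a hz ha using hex
  refine ⟨z, a, ?_, hz, ha, ?_, ?_⟩
  · ext i
    have := hz ⟨i, 0⟩
    simpa [Connecting.traj] using this.symm
  · rintro ⟨i, p⟩ ⟨i', p'⟩ h
    obtain ⟨h1, h2, h3⟩ := (hL i).merge (hL i') (hz ⟨i, p⟩) (hz ⟨i', p'⟩) (by rw [ha, ha, h])
    obtain rfl := hs h3
    obtain rfl : p = p' := by
      ext
      have : (p : ℕ) ≤ (L i : ℕ) := h1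
      have : (L i : ℕ) = p' + ((L i : ℕ) - p) := h2
      omega
    rfl
  · rintro ⟨i, p⟩ b hb
    obtain rfl : a ⟨i, p⟩ = b := by simpa [ha] using hb
    unfold nextStart
    split_ifs with h
    · have := hz ⟨i, ⟨p + 1, h⟩⟩
      dsimp only at this
      rw [Connecting.traj, hz ⟨i, p⟩, Option.bind_some, ha, Option.bind_some] at this
      exact this
    · obtain ⟨x, h1, h2, h3⟩ := hL i
      have hp : (p : ℕ) = L i := by have := p.2; dsimp only at h; omega
      rw [← hp, hz ⟨i, p⟩] at h1
      cases h1
      rw [ha] at h2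
      rw [Option.some.inj h2]
      exact h3

/-- A choice of the numbers of jumps of the walks, of the starting vertices of the segments,
and of the segments that visit the targets. -/
abbrev Pattern (V : Type) (K : ℕ) (e : Fin c → W) : Type :=
  Σ L : W → Fin K, (RunIndex L → V) × (∀ j, Fin ((L (e j) : ℕ) + 1))

/-- The segments chosen by `pos`. -/
abbrev mark {e : Fin c → W} {L : W → Fin K} (pos : ∀ j, Fin ((L (e j) : ℕ) + 1)) (j : Fin c) :
    RunIndex L :=
  ⟨e j, pos j⟩

theorem exists_pattern {e : Fin c → W} {y : W → V} {L : W → Fin K} {s : W → V}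
    (hs : Injective s) (hL : ∀ i, EndsAt S g (y i) (L i) (s i))
    (hu : ∀ j, (S.step g K).visits (y (e j)) (u j)) :
    ∃ (z : RunIndex L → V) (pos : ∀ j, Fin ((L (e j) : ℕ) + 1)),
      (fun i => z ⟨i, 0⟩) = y ∧ Good S u (mark pos) z ∧ Occurs S g z := by
  obtain ⟨z, a, h0, ht, ha, hinj, ho⟩ := exists_occurs hs hL
  have hpos : ∀ j, ∃ p : Fin ((L (e j) : ℕ) + 1), S.visits (z ⟨e j, p⟩) (u j) := by
    intro j
    obtain ⟨l, -, x, hx, hv⟩ := hu j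
    have hl := ((hL (e j)).tail hx).1
    refine ⟨⟨l, Nat.lt_succ_of_le hl⟩, ?_⟩
    have := ht ⟨e j, ⟨l, Nat.lt_succ_of_le hl⟩⟩
    dsimp only at this
    rw [hx] at this
    cases this
    exact hv
  choose pos hpos using hpos
  exact ⟨z, pos, h0, ⟨hpos, a, hinj, ha⟩, ho⟩

theorem good_step_iff {e : Fin c → W} {y : W → V} :
    Good (S.step g K) u e y ↔ ∃ x : Pattern V K e, (fun i => x.2.1 ⟨i, 0⟩) = y ∧
      Good S u (mark x.2.2) x.2.1 ∧ Occurs S g x.2.1 := by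
  constructor
  · rintro ⟨hu, s, hs, hsink⟩
    have hex := fun i => step_sink_eq_some.1 (hsink i)
    choose L hK hL using hex
    obtain ⟨z, pos, h⟩ := exists_pattern (L := fun i => ⟨L i, hK i⟩) hs hL hu
    exact ⟨⟨_, z, pos⟩, h⟩
  · rintro ⟨⟨L, z, pos⟩, rfl, ⟨hv, a, hinj, ha⟩, ho⟩
    refine ⟨fun j => ⟨pos j, by omega, _, ho.traj ha _ _ (pos j).2, hv j⟩,
      fun i => a ⟨i, Fin.last _⟩, ?_, fun i =>
        step_sink_eq_some.2 ⟨L i, (L i).2, ho.endsAt ha i⟩⟩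
    intro i i' h
    exact congrArg Sigma.fst (hinj h)

/-- The hash determines the lengths and the starts; coherence and distinct sinks determine the
segment that visits a target. Uniqueness makes the expansion an identity, usable for upper and lower
bounds. -/
theorem pattern_unique {e : Fin c → W} {y : W → V} (x x' : Pattern V K e)
    (h : (fun i => x.2.1 ⟨i, 0⟩) = y ∧ Good S u (mark x.2.2) x.2.1 ∧ Occurs S g x.2.1)
    (h' : (fun i => x'.2.1 ⟨i, 0⟩) = y ∧ Good S u (mark x'.2.2) x'.2.1 ∧ Occurs S g x'.2.1) :
    x = x' := by
  obtain ⟨L, z, pos⟩ := x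
  obtain ⟨L', z', pos'⟩ := x'
  obtain ⟨rfl, ⟨hv, a, hinj, ha⟩, ho⟩ := h
  obtain ⟨h0, ⟨hv', a', hinj', ha'⟩, ho'⟩ := h'
  have h0 : ∀ i, z' ⟨i, 0⟩ = z ⟨i, 0⟩ := fun i => congrFun h0 i
  obtain rfl : L = L' := by
    ext i
    have h1 := ho.endsAt ha i
    have h2 := ho'.endsAt ha' i
    dsimp only at h1 h2
    rw [h0] at h2
    exact (h1.unique h2).1
  obtain rfl : z = z' := by
    ext ⟨i, p⟩
    have h1 := ho.traj ha i p p.2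
    have h2 := ho'.traj ha' i p p.2
    dsimp only at h1 h2
    rw [h0, h1] at h2
    exact Option.some.inj h2
  obtain rfl : pos = pos' := by
    funext j
    have := hinj (S.coherent (hv j) (hv' j) (ha _) (ha _))
    simpa using this
  rfl

theorem occurs_iff {L : W → Fin K} {z a : RunIndex L → V}
    (ha : ∀ x, S.sink (z x) = some (a x)) : Occurs S g z ↔ ∀ x, g (a x) = nextStart z x :=
  ⟨fun ho x => ho x _ (ha x), fun ho x b hb => by
    obtain rfl : a x = b := by simpa [ha] using hb
    exact ho x⟩

variable [Fintype V]

/-- The probability that a level hash takes the value `o` at a point. -/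
def optWeight (V : Type) [Fintype V] (o : Option V) : ℝ :=
  o.elim (1 / 2) fun _ => 1 / (2 * (Fintype.card V : ℝ))

/-- The random function `h` (under the weights `w`) is `κ`-wise independent with the marginals
of a level hash. -/
def IsKWise {Ω : Type} [Fintype Ω] (κ : ℕ) (w : Ω → ℝ) (h : Ω → V → Option V) : Prop :=
  ∀ (J : Type) [Fintype J] (s : J → V), Injective s → Fintype.card J ≤ κ →
    ∀ o : J → Option V, ∑ ω, w ω * ind (∀ j, h ω (s j) = o j) = ∏ j, optWeight V (o j)

variable {Ω : Type} [Fintype Ω] {κ : ℕ} {w : Ω → ℝ} {h : Ω → V → Option V}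

/-- A walk has one stop of weight 1/2, and every jump has weight `1/(2n)`. So there is one factor
1/2 per segment, and one factor `1/n` per segment that is not the first of its walk. -/
theorem prod_optWeight_nextStart [Nonempty V] [Fintype W] {L : W → Fin K}
    (z : RunIndex L → V) :
    ∏ x, optWeight V (nextStart z x) =
      (1 / 2) ^ Fintype.card (RunIndex L) * (Fintype.card V : ℝ) ^ Fintype.card W /
        (Fintype.card V : ℝ) ^ Fintype.card (RunIndex L) := by
  have hV : (Fintype.card V : ℝ) ≠ 0 := by simp
  have h1 : ∀ i : W, ∏ p : Fin ((L i : ℕ) + 1), optWeight V (nextStart z ⟨i, p⟩) =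
      (1 / 2) ^ ((L i : ℕ) + 1) * (Fintype.card V : ℝ) / (Fintype.card V : ℝ) ^ ((L i : ℕ) + 1) := by
    intro i
    rw [Fin.prod_univ_castSucc]
    have hl : nextStart z ⟨i, Fin.last _⟩ = none := by simp [nextStart]
    have hm : ∀ p : Fin (L i : ℕ), optWeight V (nextStart z ⟨i, p.castSucc⟩) =
        1 / (2 * (Fintype.card V : ℝ)) := by
      intro p
      rw [nextStart, dif_pos (by simp)]
      rfl
    rw [hl, Finset.prod_congr rfl fun p _ => hm p]
    simp only [Finset.prod_const, Finset.card_univ, Fintype.card_fin, optWeight, Option.elim]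
    rw [div_pow, div_pow, mul_pow]
    field_simp
    ring
  rw [Fintype.prod_sigma, Finset.prod_congr rfl fun i _ => h1 i, Finset.prod_div_distrib,
    Finset.prod_mul_distrib, Finset.prod_pow_eq_pow_sum, Finset.prod_pow_eq_pow_sum,
    Fintype.card_sigma]
  simp

theorem card_runIndex_le [Fintype W] (L : W → Fin K) :
    Fintype.card (RunIndex L) ≤ K * Fintype.card W := by
  rw [Fintype.card_sigma, mul_comm]
  refine (Finset.sum_le_card_nsmul Finset.univ _ K fun i _ => ?_).trans (by simp)
  rw [Fintype.card_fin]
  exact (L i).2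

theorem IsKWise.sum_occurs [Nonempty V] [Fintype W] (hw : IsKWise κ w h)
    (hK : K * Fintype.card W ≤ κ) {L : W → Fin K} {z : RunIndex L → V} {e : Fin c → RunIndex L}
    (hz : Good S u e z) :
    ∑ ω, w ω * ind (Occurs S (h ω) z) =
      (1 / 2) ^ Fintype.card (RunIndex L) * (Fintype.card V : ℝ) ^ Fintype.card W /
        (Fintype.card V : ℝ) ^ Fintype.card (RunIndex L) := by
  obtain ⟨-, a, hinj, ha⟩ := hz
  rw [← prod_optWeight_nextStart z, ← hw _ a hinj ((card_runIndex_le L).trans hK)]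
  exact Finset.sum_congr rfl fun ω _ => by rw [occurs_iff ha]

/-- The expectation of `goodProb` after one more level, expanded over the patterns of the
walks. -/
theorem IsKWise.sum_goodProb_step [Nonempty V] [Fintype W] [DecidableEq W] (hw : IsKWise κ w h)
    (hK : K * Fintype.card W ≤ κ) (S : LevelState V) (u : Fin c → V) (e : Fin c → W) :
    ∑ ω, w ω * goodProb (S.step (h ω) K) u e =
      ∑ L : W → Fin K, (1 / 2) ^ Fintype.card (RunIndex L) *
        ∑ pos : ∀ j, Fin ((L (e j) : ℕ) + 1), goodProb S u (mark pos) := by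
  have hV : (Fintype.card V : ℝ) ≠ 0 := by simp
  have h1 : ∀ ω, w ω * goodProb (S.step (h ω) K) u e =
      ∑ x : Pattern V K e, ind (Good S u (mark x.2.2) x.2.1) *
        (w ω * ind (Occurs S (h ω) x.2.1)) / (Fintype.card V : ℝ) ^ Fintype.card W := by
    intro ω
    unfold goodProb avg
    rw [Finset.sum_congr rfl fun y _ => ind_eq_sum good_step_iff pattern_unique,
      Finset.sum_comm, ← Finset.sum_div, mul_div_assoc', Finset.mul_sum]
    congr 1
    refine Finset.sum_congr rfl fun x _ => ?_
    -- The sum over `y` absorbs the condition on the initial segments.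
    simp only [ind_and]
    rw [← Finset.sum_mul, sum_ind_eq]
    ring
  rw [Finset.sum_congr rfl fun ω _ => h1 ω, Finset.sum_comm, Fintype.sum_sigma]
  refine Finset.sum_congr rfl fun L _ => ?_
  rw [Fintype.sum_prod_type, Finset.sum_comm, Finset.mul_sum]
  refine Finset.sum_congr rfl fun pos _ => ?_
  unfold goodProb avg
  rw [Finset.sum_div, Finset.mul_sum]
  refine Finset.sum_congr rfl fun z _ => ?_
  dsimp only
  rw [← Finset.sum_div, ← Finset.mul_sum]
  by_cases hz : Good S u (mark pos) z
  -- The powers of `card V` turn the average over the walk starts into the average over all segment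
  -- starts.
  · rw [hw.sum_occurs hK hz]
    field_simp
  · rw [ind_of_not hz]
    simp

end Expansion

/-! ### The cost of adding walks. -/

section Bounds

variable {V : Type} {c : ℕ} {I I' : Type} {S : LevelState V} {u : Fin c → V}

theorem Good.comp {f : I → I'} (hf : Injective f) {e : Fin c → I} {z : I' → V}
    (h : Good S u (f ∘ e) z) : Good S u e (z ∘ f) := by
  obtain ⟨hv, a, ha, hs⟩ := h
  exact ⟨hv, a ∘ f, ha.comp hf, fun i => hs _⟩

/-- The event that, in addition to `Good`, one more walk ends where the walk `none` does. -/
def Collides (S : LevelState V) (u : Fin c → V) (z : Option (Option (Fin c)) → V) : Prop :=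
  Good S u some (z ∘ some) ∧ S.sink (z none) = S.sink (z (some none))

/-- If enlarging a good tuple makes it bad, then an added walk is bad on its own, or collides with
a walk that is good on its own. -/
theorem Good.extend {f : I → I'} {e : Fin c → I} {z : I' → V}
    (h : Good S u e (z ∘ f)) (h' : ¬Good S u (f ∘ e) z) :
    (∃ i, i ∉ Set.range f ∧ ¬Good S u some (z ∘ fun o : Option (Fin c) => o.elim i (f ∘ e))) ∨
    ∃ i, i ∉ Set.range f ∧ ∃ i', i' ∉ Set.range (f ∘ e) ∧ i' ≠ i ∧
      Collides S u (z ∘ fun o : Option (Option (Fin c)) =>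
        o.elim i fun o => o.elim i' (f ∘ e)) := by
  by_contra! hcon
  obtain ⟨h1, h2⟩ := hcon
  apply h'
  obtain ⟨hv, a, ha, hs⟩ := h
  have hsome : ∀ i, ∃ b, S.sink (z i) = some b := by
    intro i
    by_cases hi : i ∈ Set.range f
    · obtain ⟨k, rfl⟩ := hi
      exact ⟨_, hs k⟩
    · obtain ⟨-, b, -, hb⟩ := h1 i hi
      exact ⟨_, hb none⟩
  choose b hb using hsome
  have hfb : ∀ k, b (f k) = a k := fun k => by
    have := hs k
    rw [comp_apply, hb] at this
    exact Option.some.inj this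
  have key : ∀ i i', i ∉ Set.range f → i' ≠ i → b i ≠ b i' := by
    intro i i' hi hne hbb
    by_cases hi' : i' ∈ Set.range (f ∘ e)
    · obtain ⟨j, rfl⟩ := hi'
      obtain ⟨-, d, hd, hd'⟩ := h1 i hi
      have e1 : b i = d none := by
        have := hd' none; simp only [comp_apply, Option.elim, hb] at this
        exact Option.some.inj this
      have e2 : b ((f ∘ e) j) = d (some j) := by
        have := hd' (some j); simp only [comp_apply, Option.elim, hb] at this
        exact Option.some.inj this
      rw [e1, e2] at hbb
      cases hd hbb
    · apply h2 i hi i' hi' hne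
      refine ⟨?_, by simp [hb, hbb]⟩
      by_cases hf' : i' ∈ Set.range f
      · obtain ⟨k, rfl⟩ := hf'
        refine ⟨hv, fun o => o.elim (a k) (a ∘ e), ?_, ?_⟩
        -- If `e` is not injective, no added walk can be good together with the marked ones, against
        -- `h1`.
        · by_cases hinj : Injective e
          · rintro (_ | j) (_ | j') hjj
            · rfl
            · exact absurd ⟨j', congrArg f (ha hjj).symm⟩ hi'
            · exact absurd ⟨j, congrArg f (ha hjj)⟩ hi'
            · exact congrArg some (hinj (ha hjj))
          · obtain ⟨-, d, hd, hd'⟩ := h1 i hi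
            exfalso
            apply hinj
            intro j j' hjj
            have e1 := hd' (some j)
            have e2 := hd' (some j')
            simp only [comp_apply, Option.elim, hjj] at e1 e2
            rw [e1] at e2
            exact Option.some.inj (hd (Option.some.inj e2))
        · rintro (_ | j)
          · exact hs k
          · exact hs (e j)
      · exact h1 i' hf'
  refine ⟨hv, b, ?_, hb⟩
  intro i i' hbb
  by_contra hne
  by_cases hi : i ∈ Set.range f
  · by_cases hi' : i' ∈ Set.range f
    · obtain ⟨k, rfl⟩ := hi
      obtain ⟨k', rfl⟩ := hi'
      rw [hfb, hfb] at hbb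
      exact hne (congrArg f (ha hbb))
    · exact key i' i hi' hne hbb.symm
  · exact key i i' hi (Ne.symm hne) hbb

variable [Fintype V]

/-- The probability that `c` walks visit their targets and end at distinct vertices. -/
def soloProb (S : LevelState V) (u : Fin c → V) : ℝ := goodProb S u (id : Fin c → Fin c)

/-- The same with one additional walk. -/
def duoProb (S : LevelState V) (u : Fin c → V) : ℝ := goodProb S u (some : Fin c → Option (Fin c))

/-- The probability of `Collides` for independent uniform starting vertices. -/
def collProb (S : LevelState V) (u : Fin c → V) : ℝ := avg fun z => ind (Collides S u z)

theorem collProb_nonneg : 0 ≤ collProb S u := avg_nonneg fun _ => ind_nonneg _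

theorem goodProb_nonneg [Fintype I] [DecidableEq I] {e : Fin c → I} : 0 ≤ goodProb S u e :=
  avg_nonneg fun _ => ind_nonneg _

variable [Nonempty V]

theorem goodProb_comp_le [Fintype I] [DecidableEq I] [Fintype I'] [DecidableEq I'] {f : I → I'}
    (hf : Injective f) (e : Fin c → I) : goodProb S u (f ∘ e) ≤ goodProb S u e := by
  unfold goodProb
  rw [← avg_comp f hf]
  exact avg_mono fun z => ind_mono (Good.comp hf)

theorem goodProb_le_soloProb [Fintype I] [DecidableEq I] {e : Fin c → I} (he : Injective e) :
    goodProb S u e ≤ soloProb S u :=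
  goodProb_comp_le he id

/-- Union bound over the alternatives of `Good.extend`: one term for each added walk, one for each
pair of an added and another walk. By `avg_comp` each term only sees the walks it mentions. -/
theorem goodProb_sub_le [Fintype I] [DecidableEq I] [Fintype I'] [DecidableEq I'] {f : I → I'}
    (hf : Injective f) {e : Fin c → I} (he : Injective e) :
    goodProb S u e - goodProb S u (f ∘ e) ≤
      (Fintype.card I' - Fintype.card I) * (soloProb S u - duoProb S u) +
        (Fintype.card I' - Fintype.card I) * Fintype.card I' * collProb S u := by
  classical
  let C := {i // i ∉ Set.range f}
  have hC : (Fintype.card C : ℝ) = Fintype.card I' - Fintype.card I := by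
    have h1 := Fintype.card_subtype_compl (fun i => i ∈ Set.range f)
    have h2 : Fintype.card {i // i ∈ Set.range f} = Fintype.card I :=
      (Fintype.card_congr (Equiv.ofInjective f hf)).symm
    have h3 := Fintype.card_le_of_injective f hf
    have h4 : Fintype.card C = Fintype.card I' - Fintype.card I := by rw [← h2, ← h1]
    rw [h4, Nat.cast_sub h3]
  let m₁ : I' → Option (Fin c) → I' := fun i o => o.elim i (f ∘ e)
  let m₂ : I' → I' → Option (Option (Fin c)) → I' := fun i i' o => o.elim i (m₁ i')
  have hfe : Injective (f ∘ e) := hf.comp he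
  have hm₁ : ∀ i, i ∉ Set.range (f ∘ e) → Injective (m₁ i) := by
    rintro i hi (_ | j) (_ | j') hjj
    · rfl
    · exact absurd ⟨j', hjj.symm⟩ hi
    · exact absurd ⟨j, hjj⟩ hi
    · exact congrArg some (hfe hjj)
  have hm₂ : ∀ i i', i ∉ Set.range (f ∘ e) → i' ∉ Set.range (f ∘ e) → i' ≠ i →
      Injective (m₂ i i') := by
    rintro i i' hi hi' hne (_ | _ | j) (_ | _ | j') hjj
    · rfl
    · exact absurd hjj.symm hne
    · exact absurd ⟨j', hjj.symm⟩ hi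
    · exact absurd hjj hne
    · rfl
    · exact absurd ⟨j', hjj.symm⟩ hi'
    · exact absurd ⟨j, hjj⟩ hi
    · exact absurd ⟨j, hjj⟩ hi'
    · exact congrArg (some ∘ some) (hfe hjj)
  have hsub : ∀ i, i ∉ Set.range f → i ∉ Set.range (f ∘ e) := by
    rintro i hi ⟨j, hj⟩
    exact hi ⟨e j, hj⟩
  let B : (Option (Fin c) → V) → Prop := fun z => Good S u id (z ∘ some) ∧ ¬Good S u some z
  have hB : avg (fun z => ind (B z)) = soloProb S u - duoProb S u := by
    unfold soloProb duoProb goodProb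
    rw [← avg_comp (some : Fin c → Option (Fin c)) (Option.some_injective _), ← avg_sub]
    congr 1
    funext z
    by_cases h : Good S u some z
    · rw [ind_of_not fun hB => hB.2 h, ind_of h,
        ind_of (Good.comp (Option.some_injective _) (e := id) h), sub_self]
    · rw [ind_of_not h, sub_zero]
      congr 1
      simp [B, h]
  have hpt : ∀ z : I' → V, ind (Good S u e (z ∘ f)) ≤ ind (Good S u (f ∘ e) z) +
      (∑ i : C, ind (B (z ∘ m₁ i)) +
        ∑ i : C, ∑ i' : I', ind ((i' ∉ Set.range (f ∘ e) ∧ i' ≠ i) ∧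
          Collides S u (z ∘ m₂ i i'))) := by
    intro z
    have := ind_le_sum (p := Good S u e (z ∘ f)) (X := Option (C ⊕ C × I'))
      (q := fun x => x.elim (Good S u (f ∘ e) z) (Sum.elim (fun i => B (z ∘ m₁ i))
        (fun x => (x.2 ∉ Set.range (f ∘ e) ∧ x.2 ≠ x.1) ∧ Collides S u (z ∘ m₂ x.1 x.2)))) ?_
    · simpa [Fintype.sum_option, Fintype.sum_sum_type, Fintype.sum_prod_type] using this
    · intro hz
      by_cases hz' : Good S u (f ∘ e) z
      · exact ⟨none, hz'⟩
      · rcases hz.extend hz' with ⟨i, hi, h⟩ | ⟨i, hi, i', hi', hne, h⟩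
        · exact ⟨some (Sum.inl ⟨i, hi⟩), Good.comp (f := e) (e := id) he hz, h⟩
        · exact ⟨some (Sum.inr (⟨i, hi⟩, i')), ⟨hi', hne⟩, h⟩
  have hav := avg_mono hpt
  rw [avg_add, avg_add, avg_sum, avg_sum, avg_comp f hf fun z => ind (Good S u e z)] at hav
  have b1 : ∑ i : C, avg (fun z : I' → V => ind (B (z ∘ m₁ i))) =
      (Fintype.card I' - Fintype.card I) * (soloProb S u - duoProb S u) := by
    rw [Finset.sum_congr rfl fun (i : C) _ => (avg_comp (m₁ i) (hm₁ i (hsub i i.2))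
      fun z => ind (B z)).trans hB]
    rw [Finset.sum_const, Finset.card_univ, nsmul_eq_mul, hC]
  have b2 : ∑ i : C, avg (fun z : I' → V => ∑ i' : I', ind ((i' ∉ Set.range (f ∘ e) ∧ i' ≠ i) ∧
          Collides S u (z ∘ m₂ i i'))) ≤
      (Fintype.card I' - Fintype.card I) * Fintype.card I' * collProb S u := by
    rw [← hC, mul_assoc, ← nsmul_eq_mul, ← Finset.card_univ]
    refine Finset.sum_le_card_nsmul _ _ _ fun i _ => ?_
    rw [avg_sum, ← nsmul_eq_mul, ← Finset.card_univ]
    refine Finset.sum_le_card_nsmul _ _ _ fun i' _ => ?_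
    by_cases h : i' ∉ Set.range (f ∘ e) ∧ i' ≠ i
    · simp only [h, true_and, not_false_eq_true, ne_eq]
      exact (avg_comp (m₂ i i') (hm₂ i i' (hsub i i.2) h.1 h.2) fun z => ind (Collides S u z)).le
    · rw [show (fun z : I' → V => ind ((i' ∉ Set.range (f ∘ e) ∧ i' ≠ i) ∧
          Collides S u (z ∘ m₂ i i'))) = fun _ => 0 from
        funext fun z => ind_of_not fun hh => h hh.1]
      have : avg (fun _ : I' → V => (0 : ℝ)) = 0 := by simp [avg]
      rw [this]
      exact collProb_nonneg
  have : goodProb S u e = avg fun z => ind (Good S u e z) := rfl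
  have : goodProb S u (f ∘ e) = avg fun z => ind (Good S u (f ∘ e) z) := rfl
  linarith

end Bounds

/-! ### Collisions of two walks. -/

section Collision

variable {V : Type} {c K : ℕ} {S : LevelState V} {u : Fin c → V} {g : V → Option V}

/-- A pattern for the walks in `Collides`: the last walk has `l` jumps before it meets the walk
`none`. -/
abbrev CollPattern (V : Type) (c K : ℕ) : Type :=
  Σ p : (Option (Fin c) → Fin K) × Fin K,
    (RunIndex p.1 ⊕ Fin ((p.2 : ℕ) + 1) → V) × (∀ j, Fin ((p.1 j : ℕ) + 1))

abbrev collMark {L : Option (Fin c) → Fin K} {l : Fin K} (pos : ∀ j, Fin ((L j : ℕ) + 1)) :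
    Option (Option (Fin c)) → RunIndex L ⊕ Fin ((l : ℕ) + 1)
  | none => Sum.inr (Fin.last _)
  | some j => Sum.inl ⟨j, pos j⟩

/-- The queries of the walks are pairwise distinct. -/
def DistinctQueries (S : LevelState V) {L : Option (Fin c) → Fin K} {l : Fin K}
    (x : RunIndex L ⊕ Fin ((l : ℕ) + 1) → V) : Prop :=
  ∃ a : RunIndex L → V, ∃ b : Fin l → V, Injective (Sum.elim a b) ∧
    (∀ i, S.sink (x (Sum.inl i)) = some (a i)) ∧
    ∀ q : Fin l, S.sink (x (Sum.inr q.castSucc)) = some (b q)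

/-- The hash `g` makes the walks consist of the segments that start at the vertices `x`, where the
last walk is followed up to its last segment only. -/
def CollOccurs (S : LevelState V) (g : V → Option V) {L : Option (Fin c) → Fin K} {l : Fin K}
    (x : RunIndex L ⊕ Fin ((l : ℕ) + 1) → V) : Prop :=
  Occurs S g (x ∘ Sum.inl) ∧
    ∀ (q : Fin l) a, S.sink (x (Sum.inr q.castSucc)) = some a → g a = some (x (Sum.inr q.succ))

/-- Follow the extra walk only up to the first segment whose sink is already queried by the other
walks. All its earlier queries are fresh, and the meeting is itself a collision for the previous
state. -/
theorem exists_collPattern {y : Option (Option (Fin c)) → V} (h : Collides (S.step g K) u y) :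
    ∃ x : CollPattern V c K,
      (fun o : Option (Option (Fin c)) => o.elim (x.2.1 (Sum.inr 0)) fun i => x.2.1 (Sum.inl ⟨i, 0⟩))
        = y ∧
      (Collides S u (x.2.1 ∘ collMark x.2.2) ∧ DistinctQueries S x.2.1) ∧
        CollOccurs S g x.2.1 := by
  obtain ⟨⟨hu, s, hs, hsink⟩, hcol⟩ := h
  have hex := fun i => step_sink_eq_some.1 (hsink i)
  choose L' hK hL using hex
  let L : Option (Fin c) → Fin K := fun i => ⟨L' i, hK i⟩
  replace hL : ∀ i, EndsAt S g (y (some i)) (L i) (s i) := hL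
  obtain ⟨z, pos, h0, ⟨hv, a, hinj, ha⟩, ho⟩ := exists_pattern hs hL hu
  have h0' : ∀ i, z ⟨i, 0⟩ = y (some i) := fun i => congrFun h0 i
  have hw : (S.step g K).sink (y none) = some (s none) := hcol.trans (hsink none)
  obtain ⟨l₀, hl₀, hend⟩ := step_sink_eq_some.1 hw
  have hmeet : ∃ p, ∃ x : RunIndex L, ∃ v, traj S g (y none) p = some v ∧
      S.sink v = some (a x) := by
    obtain ⟨v, hv1, hv2, -⟩ := id hend
    have := ho.endsAt ha none
    rw [h0'] at this
    exact ⟨l₀, ⟨none, Fin.last _⟩, v, hv1, by rw [hv2, ((hL none).unique this).2]⟩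
  classical
  let l := Nat.find hmeet
  obtain ⟨⟨i, p⟩, v, hv1, hv2⟩ : ∃ x : RunIndex L, ∃ v, traj S g (y none) l = some v ∧
      S.sink v = some (a x) := Nat.find_spec hmeet
  have hll₀ : l ≤ l₀ := (hend.tail hv1).1
  -- After the meeting the ends agree, and the ends of the `c + 1` other walks are distinct, so the
  -- meeting is on walk `none`.
  obtain rfl : none = i := by
    have h1 := ho.traj ha i p p.2
    rw [h0'] at h1
    exact hs (hend.merge (hL i) hv1 h1 (by rw [hv2, ha])).2.2
  have hex : ∀ q : Fin (l + 1), ∃ ζ b, traj S g (y none) q = some ζ ∧ S.sink ζ = some b :=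
    fun q => hend.exists_traj (by omega)
  choose ζ b hζ hb using hex
  have hζv : ζ (Fin.last _) = v := by
    have := hζ (Fin.last _)
    rw [Fin.val_last, hv1] at this
    exact (Option.some.inj this).symm
  -- The segment of walk `none` at which the meeting happens serves as the mark of that walk.
  let pos' : ∀ j : Option (Fin c), Fin ((L j : ℕ) + 1) := fun j =>
    Option.rec (motive := fun j => Fin ((L j : ℕ) + 1)) p pos j
  refine ⟨⟨(L, ⟨l, by omega⟩), Sum.elim z ζ, pos'⟩, ?_, ⟨⟨?_, ?_⟩, ?_⟩, ?_, ?_⟩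
  · funext o
    rcases o with _ | i
    · have := hζ 0
      simpa [traj] using this.symm
    · exact h0' i
  · refine ⟨hv, fun j => a ⟨j, pos' j⟩, ?_, fun j => ha ⟨j, pos' j⟩⟩
    intro j j' hjj
    exact congrArg Sigma.fst (hinj hjj)
  · show S.sink (ζ (Fin.last _)) = S.sink (z ⟨none, p⟩)
    rw [hζv, hv2, ha]
  · refine ⟨a, fun q => b q.castSucc, ?_, ha, fun q => hb q.castSucc⟩
    have hne : ∀ x (q : Fin l), a x ≠ b q.castSucc := by
      intro x q hxq
      exact Nat.find_min hmeet q.2 ⟨x, ζ q.castSucc, hζ q.castSucc, by rw [hb, hxq]⟩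
    rintro (x | q) (x' | q') hxx
    · exact congrArg Sum.inl (hinj hxx)
    · exact absurd hxx (hne _ _)
    · exact absurd hxx.symm (hne _ _)
    · have hbb : b q.castSucc = b q'.castSucc := hxx
      have := hend.merge hend (hζ q.castSucc) (hζ q'.castSucc) (by rw [hb, hb, hbb])
      have h1 := this.1
      have h2 := this.2.1
      congr 1
      ext
      simp only [Fin.val_castSucc] at h1 h2
      omega
  · exact ho
  · intro q d hd
    have hd' : S.sink (ζ q.castSucc) = some d := hd
    have h1 := hζ q.succ
    rw [Fin.val_succ, traj, ← Fin.val_castSucc, hζ q.castSucc, Option.bind_some, hd',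
      Option.bind_some] at h1
    exact h1

variable [Fintype V] [Nonempty V]
variable {Ω : Type} [Fintype Ω] {κ : ℕ} {w : Ω → ℝ} {h : Ω → V → Option V}

/-- The extra walk pays `1/(2n)` for each of its `l` jumps and nothing for its last segment, whose
query is shared with walk `none`. -/
theorem IsKWise.sum_collOccurs (hw : IsKWise κ w h) (hK : K * (c + 2) ≤ κ)
    {L : Option (Fin c) → Fin K} {l : Fin K} {x : RunIndex L ⊕ Fin ((l : ℕ) + 1) → V}
    (hx : DistinctQueries S x) :
    ∑ ω, w ω * ind (CollOccurs S (h ω) x) =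
      (1 / 2) ^ Fintype.card (RunIndex L) * (1 / 2) ^ (l : ℕ) * (Fintype.card V : ℝ) ^ (c + 2) /
        (Fintype.card V : ℝ) ^ Fintype.card (RunIndex L ⊕ Fin ((l : ℕ) + 1)) := by
  have hV : (Fintype.card V : ℝ) ≠ 0 := by simp
  obtain ⟨a, b, hinj, ha, hb⟩ := hx
  have hcard : Fintype.card (RunIndex L ⊕ Fin (l : ℕ)) ≤ κ := by
    have := card_runIndex_le L
    rw [Fintype.card_option, Fintype.card_fin] at this
    rw [Fintype.card_sum, Fintype.card_fin]
    have := l.2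
    nlinarith
  have := hw _ (Sum.elim a b) hinj hcard
    (Sum.elim (nextStart (x ∘ Sum.inl)) fun q => some (x (Sum.inr q.succ)))
  rw [Fintype.prod_sum_type] at this
  simp only [Sum.elim_inl, Sum.elim_inr] at this
  rw [prod_optWeight_nextStart] at this
  have hev : ∀ ω, CollOccurs S (h ω) x ↔ ∀ j, h ω (Sum.elim a b j) =
      (Sum.elim (nextStart (x ∘ Sum.inl)) fun q => some (x (Sum.inr q.succ))) j := by
    intro ω
    rw [Sum.forall, CollOccurs, occurs_iff (z := x ∘ Sum.inl) (a := a) ha]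
    refine and_congr Iff.rfl ⟨fun hq q => hq q _ (hb q), fun hq q d hd => ?_⟩
    obtain rfl : b q = d := by simpa [hb] using hd
    exact hq q
  rw [Finset.sum_congr rfl fun ω _ => by rw [hev ω], this]
  simp only [optWeight, Option.elim, Finset.prod_const, Finset.card_univ, Fintype.card_fin,
    Fintype.card_option, Fintype.card_sum]
  rw [div_pow 1 (2 * _), mul_pow, div_pow 1 2 (l : ℕ), pow_add (Fintype.card V : ℝ) (Fintype.card _)]
  field_simp
  ring

theorem collMark_injective {L : Option (Fin c) → Fin K} {l : Fin K}
    (pos : ∀ j, Fin ((L j : ℕ) + 1)) : Injective (collMark (l := l) pos) := by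
  rintro (_ | i) (_ | j) hij
  · rfl
  · cases hij
  · cases hij
  · exact congrArg some (congrArg Sigma.fst (Sum.inl_injective hij))

/-- Only an upper bound is needed, so the patterns need not be unique. -/
theorem IsKWise.sum_collProb_step_le (hw : IsKWise κ w h) (hw0 : ∀ ω, 0 ≤ w ω)
    (hK : K * (c + 2) ≤ κ) (S : LevelState V) (u : Fin c → V) :
    ∑ ω, w ω * collProb (S.step (h ω) K) u ≤
      ∑ p : (Option (Fin c) → Fin K) × Fin K,
        (1 / 2) ^ Fintype.card (RunIndex p.1) * (1 / 2) ^ (p.2 : ℕ) *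
          ∑ _pos : ∀ j, Fin ((p.1 j : ℕ) + 1), collProb S u := by
  have hV : (Fintype.card V : ℝ) ≠ 0 := by simp
  let N : ℝ := (Fintype.card V : ℝ) ^ (c + 2)
  have hN : N ≠ 0 := pow_ne_zero _ hV
  have h1 : ∀ ω, w ω * collProb (S.step (h ω) K) u ≤
      ∑ x : CollPattern V c K,
        ind (Collides S u (x.2.1 ∘ collMark x.2.2) ∧ DistinctQueries S x.2.1) *
        (w ω * ind (CollOccurs S (h ω) x.2.1)) / N := by
    intro ω
    have hcard : Fintype.card (Option (Option (Fin c))) = c + 2 := by simp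
    have h2 : ∑ y, ind (Collides (S.step (h ω) K) u y) ≤ ∑ x : CollPattern V c K,
        ind (Collides S u (x.2.1 ∘ collMark x.2.2) ∧ DistinctQueries S x.2.1) *
        ind (CollOccurs S (h ω) x.2.1) := by
      refine (Finset.sum_le_sum fun y _ => ind_le_sum exists_collPattern).trans_eq ?_
      rw [Finset.sum_comm]
      refine Finset.sum_congr rfl fun x _ => ?_
      simp only [ind_and _ (_ ∧ CollOccurs _ _ _)]
      rw [← Finset.sum_mul, sum_ind_eq, one_mul, ind_and]
    unfold collProb avg
    rw [hcard, ← Finset.sum_div, mul_div_assoc']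
    refine div_le_div_of_nonneg_right ?_ (by positivity)
    refine (mul_le_mul_of_nonneg_left h2 (hw0 ω)).trans_eq ?_
    rw [Finset.mul_sum]
    exact Finset.sum_congr rfl fun x _ => by ring
  refine (Finset.sum_le_sum fun ω _ => h1 ω).trans ?_
  rw [Finset.sum_comm, Fintype.sum_sigma]
  refine Finset.sum_le_sum fun p _ => ?_
  rw [Fintype.sum_prod_type, Finset.sum_comm, Finset.mul_sum]
  refine Finset.sum_le_sum fun pos _ => ?_
  dsimp only
  rw [collProb, ← avg_comp (collMark pos) (collMark_injective (l := p.2) pos), avg, Finset.sum_div,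
    Finset.mul_sum]
  refine Finset.sum_le_sum fun x _ => ?_
  rw [← Finset.sum_div, ← Finset.mul_sum]
  by_cases hx : Collides S u (x ∘ collMark pos) ∧ DistinctQueries S x
  · rw [hw.sum_collOccurs hK hx.2, ind_of hx, ind_of hx.1]
    refine le_of_eq ?_
    change _ / N = _
    field_simp
    simp only [N]
  · rw [ind_of_not hx, zero_mul, zero_div]
    have := ind_nonneg (Collides S u (x ∘ collMark pos))
    positivity

end Collision

/-! ### Moments of truncated geometric variables. -/

section Moments

/-- The `a`-th moment of a geometric variable truncated at `K`. -/
def geomMoment (K a : ℕ) : ℝ := ∑ l : Fin K, (1 / 2) ^ ((l : ℕ) + 1) * ((l : ℕ) + 1 : ℝ) ^ a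

theorem geomMoment_succ (K a : ℕ) :
    geomMoment (K + 1) a = geomMoment K a + (1 / 2) ^ (K + 1) * (K + 1 : ℝ) ^ a := by
  simp [geomMoment, Fin.sum_univ_castSucc]

theorem geomMoment_nonneg (K a : ℕ) : 0 ≤ geomMoment K a :=
  Finset.sum_nonneg fun _ _ => by positivity

theorem geomMoment_zero (K : ℕ) : geomMoment K 0 = 1 - (1 / 2) ^ K := by
  induction K with
  | zero => simp [geomMoment]
  | succ K ih => rw [geomMoment_succ, ih]; ring

theorem geomMoment_one (K : ℕ) : geomMoment K 1 = 2 - (K + 2) * (1 / 2) ^ K := by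
  induction K with
  | zero => simp [geomMoment]
  | succ K ih => rw [geomMoment_succ, ih]; push_cast; ring

theorem geomMoment_two (K : ℕ) :
    geomMoment K 2 = 6 - (K ^ 2 + 4 * K + 6) * (1 / 2) ^ K := by
  induction K with
  | zero => simp [geomMoment]
  | succ K ih => rw [geomMoment_succ, ih]; push_cast; ring

theorem geomMoment_three (K : ℕ) :
    geomMoment K 3 = 26 - (K ^ 3 + 6 * K ^ 2 + 18 * K + 26) * (1 / 2) ^ K := by
  induction K with
  | zero => simp [geomMoment]
  | succ K ih => rw [geomMoment_succ, ih]; push_cast; ring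

theorem geomMoment_one_le (K : ℕ) : geomMoment K 1 ≤ 2 := by
  rw [geomMoment_one]; linarith [show (0 : ℝ) ≤ (K + 2) * (1 / 2) ^ K by positivity]

theorem geomMoment_two_le (K : ℕ) : geomMoment K 2 ≤ 6 := by
  rw [geomMoment_two]; linarith [show (0 : ℝ) ≤ (K ^ 2 + 4 * K + 6) * (1 / 2) ^ K by positivity]

theorem geomMoment_three_le (K : ℕ) : geomMoment K 3 ≤ 26 := by
  rw [geomMoment_three]
  linarith [show (0 : ℝ) ≤ (K ^ 3 + 6 * K ^ 2 + 18 * K + 26) * (1 / 2) ^ K by positivity]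

theorem sum_half_pow_le (K : ℕ) : ∑ l : Fin K, (1 / 2 : ℝ) ^ (l : ℕ) ≤ 2 := by
  have h : ∑ l : Fin K, (1 / 2 : ℝ) ^ (l : ℕ) = 2 * geomMoment K 0 := by
    rw [geomMoment, Finset.mul_sum]
    exact Finset.sum_congr rfl fun l _ => by ring
  rw [h, geomMoment_zero]
  linarith [show (0 : ℝ) ≤ (1 / 2) ^ K by positivity]

end Moments

/-! ### Sums over the lengths of the walks. -/

section RunSums

variable {W : Type} [Fintype W] {K : ℕ}

theorem card_runIndex (L : W → Fin K) :
    Fintype.card (RunIndex L) = ∑ i, ((L i : ℕ) + 1) := by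
  simp [Fintype.card_sigma]

/-- The product of the lengths of the walks. -/
def lenProd (L : W → Fin K) : ℝ := ∏ i, ((L i : ℕ) + 1 : ℝ)

theorem one_le_lenProd (L : W → Fin K) : 1 ≤ lenProd L :=
  Finset.one_le_prod fun _ _ => le_add_of_nonneg_left (Nat.cast_nonneg _)

theorem card_runIndex_le_lenProd (L : W → Fin K) :
    (Fintype.card (RunIndex L) : ℝ) ≤ Fintype.card W * lenProd L := by
  classical
  rw [card_runIndex, Nat.cast_sum, ← nsmul_eq_mul, ← Finset.card_univ]
  refine Finset.sum_le_card_nsmul _ _ _ fun i _ => ?_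
  rw [lenProd, ← Finset.mul_prod_erase _ _ (Finset.mem_univ i)]
  push_cast
  exact le_mul_of_one_le_right (by positivity)
    (Finset.one_le_prod fun _ _ => le_add_of_nonneg_left (Nat.cast_nonneg _))

theorem sum_lenProd_pow [DecidableEq W] (a : ℕ) :
    ∑ L : W → Fin K, (1 / 2) ^ Fintype.card (RunIndex L) * lenProd L ^ a =
      geomMoment K a ^ Fintype.card W := by
  have h : ∀ L : W → Fin K, (1 / 2 : ℝ) ^ Fintype.card (RunIndex L) * lenProd L ^ a =
      ∏ i, ((1 / 2) ^ ((L i : ℕ) + 1) * ((L i : ℕ) + 1 : ℝ) ^ a) := by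
    intro L
    rw [card_runIndex, lenProd, Finset.prod_mul_distrib, Finset.prod_pow_eq_pow_sum,
      Finset.prod_pow]
  rw [Finset.sum_congr rfl fun L _ => h L]
  have := Finset.prod_univ_sum (fun _ : W => (Finset.univ : Finset (Fin K)))
    (fun _ l => (1 / 2 : ℝ) ^ ((l : ℕ) + 1) * ((l : ℕ) + 1 : ℝ) ^ a)
  rw [Fintype.piFinset_univ] at this
  rw [← this, Finset.prod_const, Finset.card_univ]
  rfl

theorem card_pos [DecidableEq W] (L : W → Fin K) :
    (Fintype.card (∀ j, Fin ((L j : ℕ) + 1)) : ℝ) = lenProd L := by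
  simp [lenProd]

end RunSums

/-! ### One-level recursions for the three probabilities. -/

section Recursion

variable {V : Type} [Fintype V] [Nonempty V] {c K : ℕ}
variable {Ω : Type} [Fintype Ω] {κ : ℕ} {w : Ω → ℝ} {h : Ω → V → Option V}

/-- The probability that one additional walk spoils `Good`. -/
def badProb (S : LevelState V) (u : Fin c → V) : ℝ := soloProb S u - duoProb S u

theorem badProb_nonneg (S : LevelState V) (u : Fin c → V) : 0 ≤ badProb S u :=
  sub_nonneg.2 (goodProb_le_soloProb (Option.some_injective _))

theorem mark_injective {W : Type} {e : Fin c → W} (he : Injective e) {L : W → Fin K}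
    (pos : ∀ j, Fin ((L (e j) : ℕ) + 1)) : Injective (mark pos) :=
  fun _ _ h => he (congrArg Sigma.fst h)

theorem IsKWise.sum_soloProb_step_le (hw : IsKWise κ w h) (hK : K * (c + 2) ≤ κ)
    (S : LevelState V) (u : Fin c → V) :
    ∑ ω, w ω * soloProb (S.step (h ω) K) u ≤ 2 ^ c * soloProb S u := by
  have h0 : 0 ≤ soloProb S u := goodProb_nonneg
  unfold soloProb at h0 ⊢
  rw [hw.sum_goodProb_step (by rw [Fintype.card_fin]; nlinarith) S u id]
  calc _ ≤ ∑ L : Fin c → Fin K, ((1 / 2) ^ Fintype.card (RunIndex L) * lenProd L ^ 1) *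
        soloProb S u := by
        refine Finset.sum_le_sum fun L _ => ?_
        rw [mul_assoc, pow_one, ← card_pos, ← nsmul_eq_mul, ← Finset.card_univ]
        exact mul_le_mul_of_nonneg_left (Finset.sum_le_card_nsmul _ _ _ fun pos _ =>
          goodProb_le_soloProb (mark_injective injective_id pos)) (by positivity)
    _ ≤ _ := by
        rw [← Finset.sum_mul, sum_lenProd_pow, Fintype.card_fin]
        exact mul_le_mul_of_nonneg_right (pow_le_pow_left₀ (geomMoment_nonneg _ _)
          (geomMoment_one_le K) c) h0

/-- The `c + 1` walks that carry a mark give a first moment of at most 2 each, and the geometric sum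
over the jumps of the extra walk gives one more factor 2. -/
theorem IsKWise.sum_collProb_step_le' (hw : IsKWise κ w h) (hw0 : ∀ ω, 0 ≤ w ω)
    (hK : K * (c + 2) ≤ κ) (S : LevelState V) (u : Fin c → V) :
    ∑ ω, w ω * collProb (S.step (h ω) K) u ≤ 2 ^ c * (4 * collProb S u) := by
  refine (hw.sum_collProb_step_le hw0 hK S u).trans ?_
  have h0 : 0 ≤ collProb S u := collProb_nonneg
  have e1 : ∀ p : (Option (Fin c) → Fin K) × Fin K,
      (1 / 2 : ℝ) ^ Fintype.card (RunIndex p.1) * (1 / 2) ^ (p.2 : ℕ) *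
          ∑ _pos : ∀ j, Fin ((p.1 j : ℕ) + 1), collProb S u =
      (1 / 2) ^ Fintype.card (RunIndex p.1) * lenProd p.1 ^ 1 * ((1 / 2) ^ (p.2 : ℕ) *
        collProb S u) := by
    intro p
    rw [Finset.sum_const, Finset.card_univ, nsmul_eq_mul, card_pos]
    ring
  rw [Finset.sum_congr rfl fun p _ => e1 p, Fintype.sum_prod_type]
  rw [show (∑ L, ∑ l, _ : ℝ) = _ from (Fintype.sum_mul_sum
    (fun L : Option (Fin c) → Fin K => (1 / 2) ^ Fintype.card (RunIndex L) * lenProd L ^ 1)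
    (fun l : Fin K => (1 / 2) ^ (l : ℕ) * collProb S u)).symm, ← Finset.sum_mul]
  rw [sum_lenProd_pow, Fintype.card_option, Fintype.card_fin]
  have h1 := pow_le_pow_left₀ (geomMoment_nonneg _ _) (geomMoment_one_le K) (c + 1)
  have h2 := sum_half_pow_le K
  calc _ ≤ (2 : ℝ) ^ (c + 1) * (2 * collProb S u) := by gcongr
    _ = _ := by ring

/-- The number of marks is `lenProd L`, the number of added segments is at most `c * lenProd L`, and
the number of pairs at most its square. Hence the first, second and third moments, with bounds 2, 6
and 26. -/
theorem IsKWise.le_sum_soloProb_step (hw : IsKWise κ w h) (hK : K * (c + 2) ≤ κ)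
    (S : LevelState V) (u : Fin c → V) :
    geomMoment K 1 ^ c * soloProb S u - c * 6 ^ c * badProb S u - c ^ 2 * 26 ^ c * collProb S u ≤
      ∑ ω, w ω * soloProb (S.step (h ω) K) u := by
  have hb := badProb_nonneg S u
  have hc : 0 ≤ collProb S u := collProb_nonneg
  unfold soloProb
  rw [hw.sum_goodProb_step (by rw [Fintype.card_fin]; nlinarith) S u id]
  have key : ∀ L : Fin c → Fin K,
      (1 / 2) ^ Fintype.card (RunIndex L) * lenProd L ^ 1 * soloProb S u -
        (1 / 2) ^ Fintype.card (RunIndex L) * lenProd L ^ 2 * (c * badProb S u) -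
        (1 / 2) ^ Fintype.card (RunIndex L) * lenProd L ^ 3 * (c ^ 2 * collProb S u) ≤
      (1 / 2) ^ Fintype.card (RunIndex L) *
        ∑ pos : ∀ j, Fin ((L (id j) : ℕ) + 1), goodProb S u (mark pos) := by
    intro L
    have hT := one_le_lenProd L
    have hI := card_runIndex_le_lenProd L
    rw [Fintype.card_fin] at hI
    have h1 : ∀ pos : ∀ j, Fin ((L (id j) : ℕ) + 1),
        soloProb S u - c * lenProd L * badProb S u - (c * lenProd L) ^ 2 * collProb S u ≤
          goodProb S u (mark pos) := by
      intro pos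
      have := goodProb_sub_le (S := S) (u := u) (mark_injective injective_id pos) injective_id
      rw [Fintype.card_fin] at this
      change soloProb S u - goodProb S u (mark pos) ≤ _ * badProb S u + _ at this
      have h2 : ((Fintype.card (RunIndex L) : ℝ) - c) * badProb S u ≤
          c * lenProd L * badProb S u := by
        gcongr
        linarith [show (0 : ℝ) ≤ c by positivity]
      have h3 : ((Fintype.card (RunIndex L) : ℝ) - c) * Fintype.card (RunIndex L) * collProb S u ≤
          (c * lenProd L) ^ 2 * collProb S u := by
        rw [sq]
        gcongr
        linarith [show (0 : ℝ) ≤ c by positivity]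
      linarith
    have h2 := Finset.card_nsmul_le_sum Finset.univ _ _ fun pos _ => h1 pos
    rw [Finset.card_univ, nsmul_eq_mul] at h2
    rw [show (Fintype.card (∀ j, Fin ((L (id j) : ℕ) + 1)) : ℝ) = lenProd L from card_pos L] at h2
    calc _ = (1 / 2) ^ Fintype.card (RunIndex L) * (lenProd L * (soloProb S u -
          c * lenProd L * badProb S u - (c * lenProd L) ^ 2 * collProb S u)) := by ring
      _ ≤ _ := by gcongr
  refine le_trans ?_ (Finset.sum_le_sum fun L _ => key L)
  rw [Finset.sum_sub_distrib, Finset.sum_sub_distrib, ← Finset.sum_mul, ← Finset.sum_mul,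
    ← Finset.sum_mul, sum_lenProd_pow, sum_lenProd_pow, sum_lenProd_pow, Fintype.card_fin]
  have h2 := pow_le_pow_left₀ (geomMoment_nonneg _ _) (geomMoment_two_le K) c
  have h3 := pow_le_pow_left₀ (geomMoment_nonneg _ _) (geomMoment_three_le K) c
  have h4 : geomMoment K 2 ^ c * (c * badProb S u) ≤ 6 ^ c * (c * badProb S u) := by gcongr
  have h5 : geomMoment K 3 ^ c * (c ^ 2 * collProb S u) ≤ 26 ^ c * (c ^ 2 * collProb S u) := by
    gcongr
  change geomMoment K 1 ^ c * soloProb S u - _ - _ ≤ geomMoment K 1 ^ c * soloProb S u - _ - _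
  linarith

/-- Every segment of the extra walk may spoil the event; their mean number supplies the additional
factor 2. The last term accounts for an extra walk that exceeds its budget. -/
theorem IsKWise.sum_badProb_step_le (hw : IsKWise κ w h) (hK : K * (c + 2) ≤ κ)
    (S : LevelState V) (u : Fin c → V) :
    ∑ ω, w ω * badProb (S.step (h ω) K) u ≤ 2 ^ c * (2 * badProb S u) +
      (c + 1) * 6 ^ (c + 1) * collProb S u + (1 / 2) ^ K * (2 ^ c * soloProb S u) := by
  have hb := badProb_nonneg S u
  have hc : 0 ≤ collProb S u := collProb_nonneg
  -- The factor `geomMoment K 0 = 1 - 2^(-K)` inserts a dummy length for the extra walk, so that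
  -- both expansions run over the same `L`.
  have hsolo : (∑ ω, w ω * soloProb (S.step (h ω) K) u) * geomMoment K 0 =
      ∑ L : Option (Fin c) → Fin K, (1 / 2) ^ Fintype.card (RunIndex L) *
        ∑ pos : ∀ j, Fin ((L (some j) : ℕ) + 1),
          goodProb S u (mark (L := fun i => L (some i)) (e := id) pos) := by
    unfold soloProb
    rw [hw.sum_goodProb_step (by rw [Fintype.card_fin]; nlinarith) S u id, geomMoment,
      Finset.sum_mul_sum, ← Fintype.sum_prod_type']
    let E : (Fin c → Fin K) × Fin K ≃ (Option (Fin c) → Fin K) :=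
      { toFun := fun p o => o.elim p.2 p.1
        invFun := fun L => (fun i => L (some i), L none)
        left_inv := fun p => rfl
        right_inv := fun L => by ext (_ | _) <;> rfl }
    refine Fintype.sum_equiv E _ _ fun p => ?_
    have : Fintype.card (RunIndex (E p)) = Fintype.card (RunIndex p.1) + ((p.2 : ℕ) + 1) := by
      rw [card_runIndex, card_runIndex, Fintype.sum_option, add_comm]
      rfl
    rw [this, pow_zero, mul_one, mul_right_comm, ← pow_add]
    rfl
  have hduo := hw.sum_goodProb_step (by simpa using (by nlinarith : K * (c + 1) ≤ κ)) S u
    (some : Fin c → Option (Fin c))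
  have hdiff : (∑ ω, w ω * soloProb (S.step (h ω) K) u) * geomMoment K 0 -
      ∑ ω, w ω * duoProb (S.step (h ω) K) u ≤
      ∑ L : Option (Fin c) → Fin K,
        ((1 / 2) ^ Fintype.card (RunIndex L) * lenProd L ^ 1 * badProb S u +
        (1 / 2) ^ Fintype.card (RunIndex L) * lenProd L ^ 2 * ((c + 1) * collProb S u)) := by
    unfold duoProb
    rw [hsolo, hduo, ← Finset.sum_sub_distrib]
    refine Finset.sum_le_sum fun L _ => ?_
    rw [← mul_sub, mul_assoc, mul_assoc, ← mul_add]
    refine mul_le_mul_of_nonneg_left ?_ (by positivity)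
    rw [← Finset.sum_sub_distrib]
    let f : RunIndex (fun i => L (some i)) → RunIndex L := fun x => ⟨some x.1, x.2⟩
    have hf : Injective f := by
      rintro ⟨i, p⟩ ⟨i', p'⟩ hii
      obtain rfl : i = i' := Option.some.inj (congrArg Sigma.fst hii)
      have := (Sigma.mk.inj hii).2
      rw [heq_iff_eq] at this
      exact congrArg _ this
    have hT : lenProd L = ((L none : ℕ) + 1) * lenProd fun i => L (some i) := by
      rw [lenProd, Fintype.prod_option]; rfl
    have hI : (Fintype.card (RunIndex L) : ℝ) - Fintype.card (RunIndex fun i => L (some i)) =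
        (L none : ℕ) + 1 := by
      rw [card_runIndex, card_runIndex, Fintype.sum_option]
      push_cast
      ring
    have hI' := card_runIndex_le_lenProd L
    rw [Fintype.card_option, Fintype.card_fin] at hI'
    push_cast at hI'
    have h1 : ∀ pos : ∀ j, Fin ((L (some j) : ℕ) + 1),
        goodProb S u (mark (L := fun i => L (some i)) (e := id) pos) -
          goodProb S u (mark (L := L) (e := some) pos) ≤
        ((L none : ℕ) + 1) * badProb S u +
          ((L none : ℕ) + 1) * ((c + 1) * lenProd L) * collProb S u := by
      intro pos
      have := goodProb_sub_le (S := S) (u := u) hf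
        (mark_injective (L := fun i => L (some i)) injective_id pos)
      rw [hI] at this
      refine this.trans ?_
      unfold badProb
      gcongr
    have h2 := Finset.sum_le_card_nsmul Finset.univ _ _ fun pos _ => h1 pos
    rw [Finset.card_univ, nsmul_eq_mul] at h2
    rw [show (Fintype.card (∀ j, Fin ((L (some j) : ℕ) + 1)) : ℝ) =
      lenProd (fun i => L (some i)) from card_pos fun i => L (some i)] at h2
    refine h2.trans_eq ?_
    rw [hT]
    ring
  rw [Finset.sum_add_distrib, ← Finset.sum_mul, ← Finset.sum_mul, sum_lenProd_pow, sum_lenProd_pow,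
    Fintype.card_option, Fintype.card_fin, geomMoment_zero] at hdiff
  have h1 := pow_le_pow_left₀ (geomMoment_nonneg _ _) (geomMoment_one_le K) (c + 1)
  have h2 := pow_le_pow_left₀ (geomMoment_nonneg _ _) (geomMoment_two_le K) (c + 1)
  have h3 := mul_le_mul_of_nonneg_right h1 hb
  have h4 := mul_le_mul_of_nonneg_right h2 (show 0 ≤ (c + 1) * collProb S u by positivity)
  have h5 := mul_le_mul_of_nonneg_left (hw.sum_soloProb_step_le hK S u)
    (show (0 : ℝ) ≤ (1 / 2) ^ K by positivity)
  have h6 : ∑ ω, w ω * badProb (S.step (h ω) K) u =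
      ∑ ω, w ω * soloProb (S.step (h ω) K) u - ∑ ω, w ω * duoProb (S.step (h ω) K) u := by
    rw [← Finset.sum_sub_distrib]
    exact Finset.sum_congr rfl fun ω _ => by rw [badProb]; ring
  rw [h6]
  rw [pow_succ (2 : ℝ)] at h3
  linarith

end Recursion

/-! ### Values before the first level. -/

section Base

variable {V : Type} {c : ℕ} {u : Fin c → V}

theorem good_base_id (hu : Injective u) (z : Fin c → V) :
    Good (LevelState.base V) u id z ↔ u = z := by
  constructor
  · rintro ⟨hv, -⟩
    exact funext fun j => (hv j).symm
  · rintro rfl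
    exact ⟨fun j => rfl, u, hu, fun j => rfl⟩

variable [Fintype V]

theorem avg_ind_eq {I : Type} [Fintype I] [DecidableEq I] (z₀ : I → V) :
    avg (fun z => ind (z₀ = z)) = 1 / (Fintype.card V : ℝ) ^ Fintype.card I := by
  rw [avg, sum_ind_eq]

theorem soloProb_base (hu : Injective u) :
    soloProb (LevelState.base V) u = 1 / (Fintype.card V : ℝ) ^ c := by
  unfold soloProb goodProb
  simp only [good_base_id hu]
  rw [avg_ind_eq, Fintype.card_fin]

variable [Nonempty V]

theorem badProb_base_le (hu : Injective u) :
    badProb (LevelState.base V) u ≤ c / (Fintype.card V : ℝ) ^ (c + 1) := by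
  have hpt : ∀ z : Option (Fin c) → V, ind (Good (LevelState.base V) u id (z ∘ some)) ≤
      ind (Good (LevelState.base V) u some z) +
        ∑ j, ind ((fun o : Option (Fin c) => o.elim (u j) u) = z) := by
    intro z
    have := ind_le_sum (p := Good (LevelState.base V) u id (z ∘ some)) (X := Option (Fin c))
      (q := fun x => x.elim (Good (LevelState.base V) u some z)
        fun j => (fun o : Option (Fin c) => o.elim (u j) u) = z) ?_
    · simpa [Fintype.sum_option] using this
    · intro hz
      rw [good_base_id hu] at hz
      by_cases hj : ∃ j, u j = z none
      · obtain ⟨j, hj⟩ := hj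
        refine ⟨some j, funext ?_⟩
        rintro (_ | i)
        · exact hj
        · exact congrFun hz i
      · refine ⟨none, fun j => (congrFun hz j).symm, z, ?_, fun _ => rfl⟩
        rintro (_ | i) (_ | i') hii
        · rfl
        · exact absurd ⟨i', (congrFun hz i').trans hii.symm⟩ hj
        · exact absurd ⟨i, (congrFun hz i).trans hii⟩ hj
        · exact congrArg some (hu (((congrFun hz i).trans hii).trans (congrFun hz i').symm))
  have hav := avg_mono hpt
  rw [avg_add, avg_sum, avg_comp some (Option.some_injective _)
    fun z => ind (Good (LevelState.base V) u id z)] at hav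
  simp only [avg_ind_eq] at hav
  rw [Finset.sum_const, Finset.card_univ, Fintype.card_fin, Fintype.card_option, Fintype.card_fin,
    nsmul_eq_mul, mul_one_div] at hav
  have h1 : soloProb (LevelState.base V) u =
    avg fun z => ind (Good (LevelState.base V) u id z) := rfl
  have h2 : duoProb (LevelState.base V) u =
    avg fun z => ind (Good (LevelState.base V) u some z) := rfl
  rw [badProb]
  linarith

theorem collProb_base_le :
    collProb (LevelState.base V) u ≤ 1 / (Fintype.card V : ℝ) ^ (c + 1) := by
  have hV : (Fintype.card V : ℝ) ≠ 0 := by simp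
  have hpt : ∀ z : Option (Option (Fin c)) → V, ind (Collides (LevelState.base V) u z) ≤
      ∑ v, ind ((fun o : Option (Option (Fin c)) => o.elim v fun o => o.elim v u) = z) := by
    intro z
    refine ind_le_sum ?_
    rintro ⟨⟨hv, -⟩, hz⟩
    refine ⟨z none, funext ?_⟩
    rintro (_ | _ | j)
    · rfl
    · exact Option.some.inj hz
    · exact (hv j).symm
  refine (avg_mono hpt).trans_eq ?_
  rw [avg_sum]
  simp only [avg_ind_eq]
  rw [Finset.sum_const, Finset.card_univ, nsmul_eq_mul]
  simp only [Fintype.card_option, Fintype.card_fin]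
  rw [pow_succ _ (c + 1)]
  field_simp

end Base

/-! ### Iteration over the levels. -/

section LevelExp

variable {V : Type} {Ω : Type} [Fintype Ω]

/-- The expectation of `Φ` at the state after `i` independent levels. -/
def levelExp (K : ℕ) (w : ℕ → Ω → ℝ) (h : Ω → V → Option V) : ℕ → (LevelState V → ℝ) → ℝ
  | 0, Φ => Φ (LevelState.base V)
  -- The newest level is averaged innermost, so one-level bounds valid for every `S` can be inserted
  -- by monotonicity.
  | i + 1, Φ => levelExp K w h i fun S => ∑ ω, w i ω * Φ (S.step (h ω) K)

variable {K : ℕ} {w : ℕ → Ω → ℝ} {h : Ω → V → Option V}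

theorem levelExp_mono (hw : ∀ i ω, 0 ≤ w i ω) {Φ Ψ : LevelState V → ℝ} (hΦ : ∀ S, Φ S ≤ Ψ S)
    (i : ℕ) : levelExp K w h i Φ ≤ levelExp K w h i Ψ := by
  induction i generalizing Φ Ψ with
  | zero => exact hΦ _
  | succ i ih =>
    exact ih fun S => Finset.sum_le_sum fun ω _ => mul_le_mul_of_nonneg_left (hΦ _) (hw i ω)

theorem levelExp_add (Φ Ψ : LevelState V → ℝ) (i : ℕ) :
    levelExp K w h i (fun S => Φ S + Ψ S) = levelExp K w h i Φ + levelExp K w h i Ψ := by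
  induction i generalizing Φ Ψ with
  | zero => rfl
  | succ i ih => simp only [levelExp, mul_add, Finset.sum_add_distrib, ih]

theorem levelExp_mul (a : ℝ) (Φ : LevelState V → ℝ) (i : ℕ) :
    levelExp K w h i (fun S => a * Φ S) = a * levelExp K w h i Φ := by
  induction i generalizing Φ with
  | zero => rfl
  | succ i ih => simp only [levelExp, mul_left_comm _ a, ← Finset.mul_sum, ih]

theorem levelExp_nonneg (hw : ∀ i ω, 0 ≤ w i ω) {Φ : LevelState V → ℝ} (hΦ : ∀ S, 0 ≤ Φ S)
    (i : ℕ) : 0 ≤ levelExp K w h i Φ := by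
  have := levelExp_mono (K := K) (h := h) hw (Φ := fun S => 0 * Φ S) (Ψ := Φ)
    (fun S => by simpa using hΦ S) i
  rwa [levelExp_mul, zero_mul] at this

end LevelExp

/-- The growth of the three quantities over the levels. -/
theorem solo_lower_bound {c : ℕ} {M ε η N q : ℝ} (hM : 0 ≤ M) (hN : 0 < N) (hq : 0 ≤ q)
    (hε : ε ≤ 1 / N) (hη : 0 ≤ η) {s b p : ℕ → ℝ} (hs0 : s 0 = q)
    (hb0 : b 0 ≤ c * (q / N)) (hp0 : p 0 ≤ q / N) (hsn : ∀ i, 0 ≤ s i)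
    (hs : ∀ i, s (i + 1) ≤ 2 ^ c * s i) (hp : ∀ i, p (i + 1) ≤ 2 ^ c * (4 * p i))
    (hb : ∀ i, b (i + 1) ≤ 2 ^ c * (2 * b i) + M * p i + ε * (2 ^ c * s i))
    (hsl : ∀ i, 2 ^ c * (1 - η) * s i - M * b i - M * p i ≤ s (i + 1)) (i : ℕ) :
    (2 ^ c) ^ i * q * (1 - i * η - M * (c + M + 2) * 4 ^ i / N) ≤ s i := by
  have hC : (1 : ℝ) ≤ 2 ^ c := one_le_pow₀ (by norm_num)
  have hX : ∀ i : ℕ, 0 ≤ ((2 : ℝ) ^ c) ^ i * q := fun i => by positivity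
  -- Upper bounds come before the lower bound: `s`, `p`, `b` are compared with `X = (2^c)^i q`, `X
  -- 4^i/N` and a constant multiple of the latter.
  have hS : ∀ i, s i ≤ (2 ^ c) ^ i * q := by
    intro i
    induction i with
    | zero => simp [hs0]
    | succ i ih =>
      refine (hs i).trans ?_
      rw [pow_succ, mul_comm (_ ^ i), mul_assoc]
      gcongr
  have hP : ∀ i, p i ≤ (2 ^ c) ^ i * q * (4 ^ i / N) := by
    intro i
    induction i with
    | zero => simpa [div_eq_mul_inv] using hp0
    | succ i ih =>
      refine (hp i).trans ?_
      calc _ ≤ 2 ^ c * (4 * ((2 ^ c) ^ i * q * (4 ^ i / N))) := by gcongr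
        _ = _ := by ring
  have h4 : ∀ i : ℕ, (1 : ℝ) ≤ 4 ^ i := fun i => one_le_pow₀ (by norm_num)
  have hB : ∀ i, b i ≤ (c + M + 1) * ((2 ^ c) ^ i * q * (4 ^ i / N)) := by
    intro i
    induction i with
    | zero =>
      have h0 : 0 ≤ q / N := by positivity
      have : (c : ℝ) * (q / N) ≤ (c + M + 1) * (q / N) := by gcongr; linarith
      simpa [div_eq_mul_inv] using hb0.trans this
    | succ i ih =>
      refine (hb i).trans ?_
      have e1 : M * p i ≤ 2 ^ c * (M * ((2 ^ c) ^ i * q * (4 ^ i / N))) := by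
        refine (mul_le_mul_of_nonneg_left (hP i) hM).trans (le_mul_of_one_le_left ?_ hC)
        have := hX i
        positivity
      have e2 : ε * (2 ^ c * s i) ≤ 2 ^ c * ((2 ^ c) ^ i * q * (4 ^ i / N)) := by
        have h1 := hS i
        have h2 : ε ≤ 4 ^ i / N := hε.trans (by gcongr; exact h4 i)
        calc ε * (2 ^ c * s i) ≤ 4 ^ i / N * (2 ^ c * ((2 ^ c) ^ i * q)) := by
              have := hsn i
              gcongr
          _ = _ := by ring
      have e3 : 2 ^ c * (2 * b i) ≤
          2 ^ c * (2 * ((c + M + 1) * ((2 ^ c) ^ i * q * (4 ^ i / N)))) := by gcongr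
      have e4 : 0 ≤ 2 ^ c * ((2 ^ c) ^ i * q * (4 ^ i / N)) := by
        have := hX i
        positivity
      have e5 : 0 ≤ (2 * c + M + 1) * (2 ^ c * ((2 ^ c) ^ i * q * (4 ^ i / N))) := by positivity
      rw [pow_succ ((2 : ℝ) ^ c), pow_succ (4 : ℝ)]
      have e6 : (c + M + 1) * ((2 ^ c) ^ i * 2 ^ c * q * (4 ^ i * 4 / N)) =
        4 * (c + M + 1) * (2 ^ c * ((2 ^ c) ^ i * q * (4 ^ i / N))) := by ring
      rw [e6]
      linarith
  induction i with
  | zero =>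
    rw [hs0]
    have : 0 ≤ q * (M * (c + M + 2) / N) := by positivity
    simp only [pow_zero, one_mul, Nat.cast_zero, zero_mul, mul_one]
    linarith
  | succ i ih =>
    refine le_trans ?_ (hsl i)
    have f1 : 2 ^ c * ((2 ^ c) ^ i * q * (1 - i * η - M * (c + M + 2) * 4 ^ i / N)) ≤ 2 ^ c * s i := by
      gcongr
    have f2 : 2 ^ c * η * s i ≤ 2 ^ c * η * ((2 ^ c) ^ i * q) := by
      gcongr
      exact hS i
    have f3 : M * b i ≤ 2 ^ c * (M * ((c + M + 1) * ((2 ^ c) ^ i * q * (4 ^ i / N)))) := by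
      refine (mul_le_mul_of_nonneg_left (hB i) hM).trans (le_mul_of_one_le_left ?_ hC)
      have := hX i
      positivity
    have f4 : M * p i ≤ 2 ^ c * (M * ((2 ^ c) ^ i * q * (4 ^ i / N))) := by
      refine (mul_le_mul_of_nonneg_left (hP i) hM).trans (le_mul_of_one_le_left ?_ hC)
      have := hX i
      positivity
    have f5 : 0 ≤ 2 ^ c * (M * (c + M + 2) * ((2 ^ c) ^ i * q * (4 ^ i / N))) := by
      have := hX i
      positivity
    -- Since `4^(i+1) - 4^i = 3·4^i`, the growth of the error term covers the new losses `f3` and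
    -- `f4`.
    have f6 : (2 ^ c) ^ (i + 1) * q * (1 - ((i + 1 : ℕ) : ℝ) * η -
          M * (c + M + 2) * 4 ^ (i + 1) / N) =
        2 ^ c * ((2 ^ c) ^ i * q * (1 - i * η - M * (c + M + 2) * 4 ^ i / N)) -
        2 ^ c * η * ((2 ^ c) ^ i * q) -
        3 * (2 ^ c * (M * (c + M + 2) * ((2 ^ c) ^ i * q * (4 ^ i / N)))) := by
      push_cast
      ring
    rw [f6]
    linarith

/-! ### Lower bounds after all levels. -/

section Main

variable {V : Type} [Fintype V] [Nonempty V] {c K κ : ℕ} {Ω : Type} [Fintype Ω]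
  {w : ℕ → Ω → ℝ} {h : Ω → V → Option V}

theorem le_geomMoment_one_pow (K c : ℕ) :
    2 ^ c * (1 - c * (K + 2) * (1 / 2) ^ K) ≤ geomMoment K 1 ^ c := by
  have h0 := geomMoment_nonneg K 1
  rw [geomMoment_one] at h0 ⊢
  have h1 := one_add_mul_le_pow (a := -((K + 2) * (1 / 2) ^ K / 2 : ℝ)) (by linarith) c
  have h2 : (2 - (K + 2) * (1 / 2) ^ K : ℝ) = 2 * (1 + -((K + 2) * (1 / 2) ^ K / 2)) := by ring
  rw [h2, mul_pow]
  refine mul_le_mul_of_nonneg_left (le_trans ?_ h1) (by positivity)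
  have : (0 : ℝ) ≤ c * (K + 2) * (1 / 2) ^ K := by positivity
  linarith

/-- A bound for the error coefficients of one level. -/
def errConst (c : ℕ) : ℝ := (c + 1) ^ 2 * 26 ^ (c + 1)

theorem levelExp_soloProb_ge (hw : ∀ i, IsKWise κ (w i) h) (hw0 : ∀ i ω, 0 ≤ w i ω)
    (hK : K * (c + 2) ≤ κ) (hKn : (1 / 2) ^ K ≤ 1 / (Fintype.card V : ℝ)) {u : Fin c → V}
    (hu : Injective u) (i : ℕ) :
    (2 ^ c) ^ i * (1 / (Fintype.card V : ℝ) ^ c) *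
      (1 - i * (c * (K + 2) * (1 / 2) ^ K) -
        errConst c * (c + errConst c + 2) * 4 ^ i / Fintype.card V) ≤
      levelExp K w h i fun S => soloProb S u := by
  have hV : (Fintype.card V : ℝ) ≠ 0 := by simp
  have hcoll : ∀ S : LevelState V, 0 ≤ collProb S u := fun S => collProb_nonneg
  have hM1 : (c + 1) * 6 ^ (c + 1) ≤ errConst c := by
    unfold errConst
    gcongr
    · nlinarith [show (0 : ℝ) ≤ c by positivity]
    · norm_num
  have hM2 : (c : ℝ) * 6 ^ c ≤ errConst c := by
    refine le_trans ?_ hM1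
    gcongr
    · linarith
    · norm_num
    · omega
  have hM3 : (c : ℝ) ^ 2 * 26 ^ c ≤ errConst c := by
    unfold errConst
    gcongr
    · linarith
    · norm_num
    · omega
  refine solo_lower_bound (c := c) (M := errConst c) (ε := (1 / 2) ^ K)
    (s := fun i => levelExp K w h i fun S => soloProb S u)
    (b := fun i => levelExp K w h i fun S => badProb S u)
    (p := fun i => levelExp K w h i fun S => collProb S u)
    (by unfold errConst; positivity) (by positivity) (by positivity) hKn (by positivity)
    (soloProb_base hu) ?_ ?_
    (fun i => levelExp_nonneg hw0 (fun S => goodProb_nonneg) i) ?_ ?_ ?_ ?_ i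
  · refine (badProb_base_le hu).trans_eq ?_
    rw [pow_succ]
    field_simp
  · refine collProb_base_le.trans_eq ?_
    rw [pow_succ]
    field_simp
  · intro i
    have := levelExp_mono (K := K) (h := h) hw0
      (fun S => (hw i).sum_soloProb_step_le hK S u) i
    rwa [levelExp_mul] at this
  · intro i
    have := levelExp_mono (K := K) (h := h) hw0
      (fun S => (hw i).sum_collProb_step_le' (hw0 i) hK S u) i
    rwa [levelExp_mul, levelExp_mul] at this
  · intro i
    have := levelExp_mono (K := K) (h := h) hw0
      (Ψ := fun S => 2 ^ c * (2 * badProb S u) + errConst c * collProb S u +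
          (1 / 2) ^ K * (2 ^ c * soloProb S u))
      (fun S => ((hw i).sum_badProb_step_le hK S u).trans
        (add_le_add_left (add_le_add_right
          (mul_le_mul_of_nonneg_right hM1 (hcoll S)) _) _)) i
    rwa [levelExp_add, levelExp_add, levelExp_mul, levelExp_mul, levelExp_mul, levelExp_mul,
      levelExp_mul] at this
  · intro i
    have hpt : ∀ S : LevelState V, 2 ^ c * (1 - c * (K + 2) * (1 / 2) ^ K) * soloProb S u +
        (-errConst c) * badProb S u + (-errConst c) * collProb S u ≤
        ∑ ω, w i ω * soloProb (S.step (h ω) K) u := by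
      intro S
      have h1 := (hw i).le_sum_soloProb_step hK S u
      have h2 := mul_le_mul_of_nonneg_right (le_geomMoment_one_pow K c)
        (show 0 ≤ soloProb S u from goodProb_nonneg)
      have h3 := mul_le_mul_of_nonneg_right hM2 (badProb_nonneg S u)
      have h4 := mul_le_mul_of_nonneg_right hM3 (hcoll S)
      linarith
    have := levelExp_mono (K := K) (h := h) hw0 hpt i
    rw [levelExp_add, levelExp_add, levelExp_mul, levelExp_mul, levelExp_mul] at this
    refine le_trans (le_of_eq ?_) this
    ring

/-- A single walk can collect all targets on the last level. -/
theorem IsKWise.le_sum_goodProb_unit (hc : 1 ≤ c) {w : Ω → ℝ} (hw : IsKWise κ w h)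
    (hcK : c ≤ K) (hK : K ≤ κ) (S : LevelState V) (u : Fin c → V) :
    (1 / 2) ^ c * soloProb S u ≤
      ∑ ω, w ω * goodProb (S.step (h ω) K) u (fun _ : Fin c => ()) := by
  rw [hw.sum_goodProb_step (by simpa using hK) S u]
  -- Only one term of the expansion is kept: `c - 1` jumps, that is `c` segments, with target `j`
  -- visited in segment `j`.
  let L : Unit → Fin K := fun _ => ⟨c - 1, by omega⟩
  let pos : Fin c → Fin ((L () : ℕ) + 1) := fun j => ⟨j, by simp only [L]; omega⟩
  let f : RunIndex L → Fin c := fun x => ⟨x.2, by have := x.2.2; simp only [L] at this; omega⟩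
  have hf : Injective f := by
    rintro ⟨⟨⟩, p⟩ ⟨⟨⟩, p'⟩ hpp
    have : p = p' := by
      ext
      exact Fin.mk.inj_iff.1 hpp
    rw [this]
  have hcard : Fintype.card (RunIndex L) = c := by
    rw [card_runIndex]
    simp only [L, Finset.univ_unique, Finset.sum_singleton]
    omega
  have h0 : ∀ L : Unit → Fin K, 0 ≤ (1 / 2 : ℝ) ^ Fintype.card (RunIndex L) *
        ∑ pos : Fin c → Fin ((L () : ℕ) + 1), goodProb S u (mark (e := fun _ => ()) pos) :=
    fun L => mul_nonneg (by positivity) (Finset.sum_nonneg fun _ _ => goodProb_nonneg)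
  refine le_trans ?_ (Finset.single_le_sum (fun L _ => h0 L) (Finset.mem_univ L))
  rw [hcard]
  refine mul_le_mul_of_nonneg_left ?_ (by positivity)
  refine le_trans ?_ (Finset.single_le_sum
    (f := fun pos : Fin c → Fin ((L () : ℕ) + 1) => goodProb S u (mark (e := fun _ => ()) pos))
    (fun _ _ => goodProb_nonneg) (Finset.mem_univ pos))
  exact goodProb_comp_le hf (mark (e := fun _ => ()) pos)

theorem levelExp_goodProb_unit_ge (hc : 1 ≤ c) (hw : ∀ i, IsKWise κ (w i) h)
    (hw0 : ∀ i ω, 0 ≤ w i ω) (hcK : c ≤ K) (hK : K * (c + 2) ≤ κ)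
    (hKn : (1 / 2) ^ K ≤ 1 / (Fintype.card V : ℝ)) {u : Fin c → V} (hu : Injective u) (i : ℕ) :
    (1 / 2) ^ c * ((2 ^ c) ^ i * (1 / (Fintype.card V : ℝ) ^ c) *
      (1 - i * (c * (K + 2) * (1 / 2) ^ K) -
        errConst c * (c + errConst c + 2) * 4 ^ i / Fintype.card V)) ≤
      levelExp K w h (i + 1) fun S => goodProb S u (fun _ : Fin c => ()) := by
  refine (mul_le_mul_of_nonneg_left (levelExp_soloProb_ge hw hw0 hK hKn hu i)
    (by positivity)).trans ?_
  rw [← levelExp_mul]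
  exact levelExp_mono hw0 (fun S => (hw i).le_sum_goodProb_unit hc hcK (by nlinarith) S u) i

end Main

/-! ### Probabilities as finite sums. -/

section Law

variable {α β : Type}

theorem pr_nonneg (p : PMF α) (E : Set α) : 0 ≤ pr p E := ENNReal.toReal_nonneg

theorem pr_map (p : PMF α) (f : α → β) (E : Set β) : pr (p.map f) E = pr p (f ⁻¹' E) := by
  rw [pr, PMF.toOuterMeasure_map_apply, pr]

variable [Fintype α] [Fintype β]

theorem pr_eq_sum (p : PMF α) (E : Set α) : pr p E = ∑ x, (p x).toReal * ind (x ∈ E) := by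
  rw [pr, PMF.toOuterMeasure_apply_fintype, ENNReal.toReal_sum]
  · refine Finset.sum_congr rfl fun x _ => ?_
    by_cases hx : x ∈ E <;> simp [hx, ind]
  · intro x _
    by_cases hx : x ∈ E <;> simp [hx, p.apply_ne_top]

theorem pr_singleton (p : PMF α) (x : α) : pr p {y | y = x} = (p x).toReal := by
  rw [pr_eq_sum, Finset.sum_eq_single x]
  · rw [ind_of (by simp), mul_one]
  · intro y _ hy
    rw [ind_of_not (p := y ∈ {y | y = x}) hy, mul_zero]
  · simp

theorem sum_pr_fiber (p : PMF α) (f : α → β) (φ : β → ℝ) :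
    ∑ b, pr p {x | f x = b} * φ b = ∑ x, (p x).toReal * φ (f x) := by
  simp only [pr_eq_sum, Finset.sum_mul]
  rw [Finset.sum_comm]
  refine Finset.sum_congr rfl fun x _ => ?_
  rw [Finset.sum_eq_single (f x)]
  · rw [ind_of (by simp), mul_one]
  · intro b _ hb
    rw [ind_of_not (p := x ∈ {x | f x = b}) fun h => hb (Eq.symm h), mul_zero, zero_mul]
  · simp

end Law

/-! ### From level states to reachability under the final hash. -/

section States

variable {V Ω : Type} {K : ℕ} {h : Ω → V → Option V}

/-- The state after the levels with hashes `h (f 0), h (f 1), …`. -/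
def stateOf (K : ℕ) (h : Ω → V → Option V) : (t : ℕ) → (Fin t → Ω) → LevelState V
  | 0, _ => LevelState.base V
  | t + 1, f => (stateOf K h t (Fin.init f)).step (h (f (Fin.last t))) K

theorem levelExp_eq_sum [Fintype Ω] (w : ℕ → Ω → ℝ) (t : ℕ) (Φ : LevelState V → ℝ) :
    levelExp K w h t Φ = ∑ f : Fin t → Ω, (∏ i : Fin t, w i (f i)) * Φ (stateOf K h t f) := by
  induction t generalizing Φ with
  | zero => simp [levelExp, stateOf]
  | succ t ih =>
    rw [levelExp, ih, ← (Fin.snocEquiv fun _ => Ω).sum_comp, Fintype.sum_prod_type_right]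
    refine Finset.sum_congr rfl fun f _ => ?_
    rw [Finset.mul_sum]
    refine Finset.sum_congr rfl fun ω _ => ?_
    rw [Fin.prod_univ_castSucc, stateOf]
    simp only [Fin.snocEquiv, Equiv.coe_fn_mk, Fin.snoc_castSucc, Fin.snoc_last, Fin.init_snoc,
      Fin.val_castSucc, Fin.val_last]
    ring

end States

section Reach

variable {n m t K : ℕ} (a : Fin n → Fin m)

/-- The restriction of a hash to the points `a x`. -/
abbrev pull (a : Fin n → Fin m) (g : Fin m → Option (Fin n)) (x : Fin n) : Option (Fin n) :=
  g (a x)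

theorem finalHash_succ (f : Fin (t + 1) → Fin m → Option (Fin n)) (j : Fin m) :
    finalHash f j = (finalHash (Fin.init f) j).or (f (Fin.last t) j) := by
  unfold finalHash
  rw [List.finRange_succ_last, List.findSome?_append, List.findSome?_map]
  congr 1
  cases h : f (Fin.last t) j <;> simp [h]

variable {a}

theorem outSet_mono {g g' : Fin m → Option (Fin n)}
    (h : ∀ v w, g (a v) = some w → g' (a v) = some w) (x : Fin n) :
    outSet a g x ⊆ outSet a g' x :=
  fun _ hy => Relation.ReflTransGen.mono (fun v w hvw => h v w hvw) _ _ hy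

theorem outSet_trans {g : Fin m → Option (Fin n)} {x y z : Fin n} (h : y ∈ outSet a g x)
    (h' : z ∈ outSet a g y) : z ∈ outSet a g x :=
  Relation.ReflTransGen.trans h h'

/-- At a sink all previous levels are `0`, so there the final hash agrees with the new level.
Elsewhere a later level never changes a value already fixed, so old edges persist. -/
theorem stateOf_reach (f : Fin t → Fin m → Option (Fin n)) :
    (∀ y s, (stateOf K (pull a) t f).sink y = some s →
      s ∈ outSet a (finalHash f) y ∧ finalHash f (a s) = none) ∧
    ∀ y u, (stateOf K (pull a) t f).visits y u → u ∈ outSet a (finalHash f) y := by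
  induction t with
  | zero =>
    refine ⟨fun y s hs => ?_, fun y u hu => ?_⟩
    · cases hs
      exact ⟨Relation.ReflTransGen.refl, rfl⟩
    · cases hu
      exact Relation.ReflTransGen.refl
  | succ t ih =>
    obtain ⟨ih1, ih2⟩ := ih (Fin.init f)
    set S := stateOf K (pull a) t (Fin.init f)
    set g := pull a (f (Fin.last t))
    have hsub : ∀ x, outSet a (finalHash (Fin.init f)) x ⊆ outSet a (finalHash f) x := by
      refine fun x => outSet_mono (fun v w hvw => ?_) x
      rw [finalHash_succ, hvw, Option.some_or]
    have hnew : ∀ s, finalHash (Fin.init f) (a s) = none → finalHash f (a s) = g s := by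
      intro s hs
      rw [finalHash_succ, hs, Option.none_or]
    have htraj : ∀ y p z, traj S g y p = some z → z ∈ outSet a (finalHash f) y := by
      intro y p
      induction p with
      | zero => rintro z ⟨⟩; exact Relation.ReflTransGen.refl
      | succ p ihp =>
        intro z hz
        rw [traj, Option.bind_eq_some_iff] at hz
        obtain ⟨x, hx, hz⟩ := hz
        rw [Option.bind_eq_some_iff] at hz
        obtain ⟨s, hs, hz⟩ := hz
        obtain ⟨h1, h2⟩ := ih1 x s hs
        refine outSet_trans (ihp x hx) (outSet_trans (hsub _ h1) ?_)
        exact Relation.ReflTransGen.single (by rw [hnew s h2, hz])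
    refine ⟨fun y s hs => ?_, ?_⟩
    · obtain ⟨l, -, z, hz, hzs, hg⟩ := step_sink_eq_some.1 hs
      obtain ⟨h1, h2⟩ := ih1 z s hzs
      exact ⟨outSet_trans (htraj y l z hz) (hsub _ h1), (hnew s h2).trans hg⟩
    · rintro y u ⟨l, -, z, hz, hv⟩
      exact outSet_trans (htraj y l z hz) (hsub _ (ih2 z u hv))

theorem reachProb_eq_sum {Ω : Type} [Fintype Ω] {c : ℕ} (p : PMF Ω)
    (h : Ω → Fin m → Option (Fin n)) (a : Fin n → Fin m) (u : Fin c → Fin n) :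
    reachProb (p.map h) a u =
      ∑ ω, (p ω).toReal * ((∑ x, ind (∀ i, u i ∈ outSet a (h ω) x)) / n) := by
  unfold reachProb
  simp only [pr_map]
  simp only [pr_eq_sum]
  rw [Finset.sum_comm, Finset.sum_div]
  refine Finset.sum_congr rfl fun ω _ => ?_
  rw [← Finset.mul_sum, mul_div_assoc]
  rfl

variable {κ : ℕ} {Q : PMF (Fin t → Fin m → Option (Fin n))}

/-- The law of a single level. -/
def levelWeight (Q : PMF (Fin t → Fin m → Option (Fin n))) (i : Fin t)
    (g : Fin m → Option (Fin n)) : ℝ := pr Q {h | h i = g}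

theorem _root_.IsLevelLaw.isKWise (hQ : IsLevelLaw n m t κ Q) (ha : Injective a) (i : Fin t) :
    IsKWise κ (levelWeight Q i) (pull a) := by
  intro J _ s hs hJ o
  classical
  have has : Injective fun j => a (s j) := ha.comp hs
  let y : Fin m → Option (Fin n) := extend (fun j => a (s j)) o fun _ => none
  have hy : ∀ j, y (a (s j)) = o j := fun j => has.extend_apply o _ j
  have hmarg : ∀ j v, pr Q {h | h i j = v} = optWeight (Fin n) v := by
    intro j v
    cases v with
    | none => exact hQ.marginal_zero i j
    | some v => simpa [optWeight] using hQ.marginal_vertex i j v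
  have h1 := hQ.kwise i (Finset.univ.image fun j => a (s j))
    (by rwa [Finset.card_image_of_injective _ has, Finset.card_univ]) y
  rw [Finset.prod_image fun j _ j' _ h => has h] at h1
  simp only [hmarg, hy] at h1
  unfold levelWeight
  rw [sum_pr_fiber Q (fun h => h i) fun g => ind (∀ j, pull a g (s j) = o j), ← h1, pr_eq_sum]
  refine Finset.sum_congr rfl fun h _ => ?_
  congr 2
  simp [hy, pull]

/-- Independence of the levels identifies the product of the level weights with `Q`; a good walk
then certifies reachability. -/
theorem _root_.IsLevelLaw.levelExp_le_reachProb (hQ : IsLevelLaw n m t κ Q) {c : ℕ}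
    (u : Fin c → Fin n) {w : ℕ → (Fin m → Option (Fin n)) → ℝ}
    (hw : ∀ i : Fin t, w i = levelWeight Q i) :
    levelExp K w (pull a) t (fun S => goodProb S u (fun _ : Fin c => ())) ≤
      reachProb (finalLaw Q) a u := by
  rw [levelExp_eq_sum, finalLaw, reachProb_eq_sum]
  refine Finset.sum_le_sum fun f _ => ?_
  have hf : ∏ i : Fin t, w i (f i) = (Q f).toReal := by
    rw [← pr_singleton, Finset.prod_congr rfl fun i _ => congrFun (hw i) (f i)]
    unfold levelWeight
    rw [← hQ.indep f]
    congr 1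
    ext g
    exact funext_iff.symm
  rw [hf]
  refine mul_le_mul_of_nonneg_left ?_ ENNReal.toReal_nonneg
  unfold goodProb avg
  rw [Fintype.card_unit, pow_one, Fintype.card_fin]
  refine div_le_div_of_nonneg_right ?_ (Nat.cast_nonneg _)
  rw [← (Equiv.funUnique Unit (Fin n)).symm.sum_comp]
  refine Finset.sum_le_sum fun x _ => ind_mono ?_
  rintro ⟨hv, -⟩ j
  exact (stateOf_reach f).2 _ _ (hv j)

theorem _root_.IsLevelLaw.reachProb_ge (hQ : IsLevelLaw n m t κ Q) (hn : 0 < n) (ht : 1 ≤ t)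
    (ha : Injective a) {c : ℕ} (hc : 1 ≤ c) (hcK : c ≤ K) (hK : K * (c + 2) ≤ κ)
    (hKn : (1 / 2) ^ K ≤ 1 / (n : ℝ)) {u : Fin c → Fin n} (hu : Injective u) :
    (1 / 2) ^ c * ((2 ^ c) ^ (t - 1) * (1 / (n : ℝ) ^ c) *
      (1 - ((t - 1 : ℕ) : ℝ) * (c * (K + 2) * (1 / 2) ^ K) -
        errConst c * (c + errConst c + 2) * 4 ^ (t - 1) / n)) ≤
      reachProb (finalLaw Q) a u := by
  have : Nonempty (Fin n) := ⟨⟨0, hn⟩⟩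
  -- Only `t` laws exist; the last one is repeated to obtain a sequence.
  let w : ℕ → (Fin m → Option (Fin n)) → ℝ := fun i => levelWeight Q ⟨min i (t - 1), by omega⟩
  have h1 := levelExp_goodProb_unit_ge (V := Fin n) (κ := κ) hc
    (w := w) (fun i => hQ.isKWise ha _) (fun i g => pr_nonneg _ _) hcK hK
    (by rwa [Fintype.card_fin]) hu (t - 1)
  rw [Nat.sub_add_cancel ht, Fintype.card_fin] at h1
  refine h1.trans (hQ.levelExp_le_reachProb u fun i => ?_)
  simp only [w]
  congr 1
  ext
  have := i.2
  simp only
  omega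

end Reach

/-! ### Asymptotics and the choice of constants for the first part. -/

section Numerics

theorem eventually_log_sq_le (A : ℝ) :
    ∀ᶠ n : ℕ in atTop, A * Real.logb 2 n ^ 2 ≤ n := by
  have h2 : 0 < Real.log 2 := Real.log_pos (by norm_num)
  have h := (Real.isLittleO_pow_log_id_atTop (n := 2)).comp_tendsto tendsto_natCast_atTop_atTop
  have hpos : 0 < Real.log 2 ^ 2 / (|A| + 1) := by positivity
  filter_upwards [h.bound hpos] with n hn
  simp only [comp_apply, id, Real.norm_eq_abs, abs_pow, sq_abs, Nat.abs_cast] at hn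
  rw [Real.logb, div_pow, mul_div_assoc', div_le_iff₀ (by positivity)]
  rw [div_mul_eq_mul_div, le_div_iff₀ (by positivity)] at hn
  calc A * Real.log n ^ 2 ≤ (|A| + 1) * Real.log n ^ 2 := by
        gcongr
        linarith [le_abs_self A]
    _ ≤ n * Real.log 2 ^ 2 := by linarith

theorem eventually_le_logb (A : ℝ) : ∀ᶠ n : ℕ in atTop, A ≤ Real.logb 2 n :=
  ((Real.tendsto_logb_atTop (by norm_num)).comp tendsto_natCast_atTop_atTop).eventually_ge_atTop A

theorem rpow_neg_half {n : ℝ} (hn : 0 < n) (c : ℕ) :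
    n ^ (-(c : ℝ) / 2) = (((2 : ℝ) ^ (Real.logb 2 n / 2)) ^ c)⁻¹ := by
  rw [← Real.rpow_natCast, ← Real.rpow_neg (by positivity), ← Real.rpow_mul (by norm_num)]
  conv_lhs => rw [← Real.rpow_logb (b := 2) (by norm_num) (by norm_num) hn]
  rw [← Real.rpow_mul (by norm_num)]
  congr 1
  ring

end Numerics

theorem exists_isConnecting_finalLaw (c : ℕ) (hc : 1 ≤ c) :
    ∃ D : ℝ, 1 ≤ D ∧ ∃ δ : ℝ, 0 < δ ∧ ∃ n₀ : ℕ, ∀ n m t κ : ℕ, n₀ ≤ n → n ≤ m →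
      |(t : ℝ) - (1 / 2 * Real.logb 2 n - D)| < 1 →
      |(κ : ℝ) - 5 * c * Real.logb 2 n| < 1 →
      ∀ Q : PMF (Fin t → Fin m → Option (Fin n)), IsLevelLaw n m t κ Q →
        IsConnecting c δ (finalLaw Q) := by
  set E : ℝ := errConst c * (c + errConst c + 2) with hE
  -- With `D = d + 1`, the collision error `E 4^(t-1)/n` is at most `E/4^d < 1/4`. Rounding gives `t
  -- - 1 > (log n)/2 - (d + 3)`, which is the source of the exponent in `δ`.
  obtain ⟨d, hd⟩ := pow_unbounded_of_one_lt (4 * E) (show (1 : ℝ) < 4 by norm_num)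
  have hc1 : (1 : ℝ) ≤ c := by exact_mod_cast hc
  refine ⟨(d + 1 : ℕ), by simp, (1 / 2) ^ (c + 1) * ((1 / 2) ^ (d + 3)) ^ c, by positivity, ?_⟩
  obtain ⟨n₀, hn₀⟩ := eventually_atTop.1 ((eventually_le_logb (2 * d + c + 7)).and
    ((eventually_log_sq_le (32 * c ^ 2)).and (eventually_gt_atTop 0)))
  refine ⟨n₀, fun n m t κ hn _ ht hκ Q hQ a ha u hu => ?_⟩
  obtain ⟨hL, hsq, hn0⟩ := hn₀ n hn
  have hnR : (0 : ℝ) < n := by exact_mod_cast hn0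
  set L := Real.logb 2 n with hLdef
  have h2L : (2 : ℝ) ^ L = n := Real.rpow_logb (by norm_num) (by norm_num) hnR
  have hd0 : (0 : ℝ) ≤ d := Nat.cast_nonneg d
  rw [abs_lt] at ht hκ
  push_cast at ht
  have ht1 : 1 ≤ t := by
    have : (0 : ℝ) < t := by linarith
    exact_mod_cast this
  have hti : ((t - 1 : ℕ) : ℝ) = t - 1 := by rw [Nat.cast_sub ht1, Nat.cast_one]
  -- Collisions involve `c + 2` walks of at most `K` segments each. As `c + 2 ≤ 3c`, this `K` still
  -- exceeds `log n` for large `n`.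
  set K := κ / (c + 2) with hK
  have hKκ : K * (c + 2) ≤ κ := Nat.div_mul_le_self _ _
  have hcK : c ≤ K := by
    rw [hK, Nat.le_div_iff_mul_le (by omega)]
    have : ((c * (c + 2) : ℕ) : ℝ) ≤ κ := by
      push_cast
      nlinarith
    exact_mod_cast this
  have hKL : L ≤ K := by
    have h1 : κ < (K + 1) * (c + 2) := by
      have := Nat.lt_div_mul_add (a := κ) (b := c + 2) (by omega)
      rw [← hK] at this
      linarith
    have h2 : (κ : ℝ) < (K + 1) * (c + 2) := by exact_mod_cast h1
    by_contra hlt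
    push Not at hlt
    nlinarith
  have hKn : ((1 : ℝ) / 2) ^ K ≤ 1 / n := by
    rw [div_pow, one_pow, ← h2L, ← Real.rpow_natCast]
    exact one_div_le_one_div_of_le (by positivity)
      (Real.rpow_le_rpow_of_exponent_le (by norm_num) hKL)
  refine le_trans ?_ (hQ.reachProb_ge hn0 ht1 ha hc hcK hKκ hKn hu.injective)
  have hT1 : ((t - 1 : ℕ) : ℝ) * (c * (K + 2) * (1 / 2) ^ K) ≤ 1 / 4 := by
    have hKle : (K : ℝ) ≤ 5 * c * L + 1 := by
      have h1 : (K : ℝ) ≤ κ := by exact_mod_cast Nat.div_le_self κ (c + 2)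
      linarith
    have hcL : 1 ≤ c * L := by nlinarith
    calc ((t - 1 : ℕ) : ℝ) * (c * (K + 2) * (1 / 2) ^ K) ≤ L * (c * (8 * (c * L)) * (1 / n)) := by
          have h1 : ((t - 1 : ℕ) : ℝ) ≤ L := by rw [hti]; linarith
          have h2 : (K : ℝ) + 2 ≤ 8 * (c * L) := by linarith
          gcongr
          linarith
      _ = (32 * c ^ 2 * L ^ 2) / n / 4 := by ring
      _ ≤ 1 / 4 := by
          gcongr
          exact div_le_one_of_le₀ hsq hnR.le
  have hT2 : E * 4 ^ (t - 1) / n ≤ 1 / 4 := by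
    have hE0 : 0 ≤ E := by
      have : 0 ≤ errConst c := by unfold errConst; positivity
      positivity
    have h4 : (4 : ℝ) ^ (t - 1) * 4 ^ d ≤ n := by
      have e : ∀ k : ℕ, (4 : ℝ) ^ k = 2 ^ (2 * k : ℝ) := fun k => by
        rw [Real.rpow_mul (by norm_num), Real.rpow_natCast]
        norm_num
      rw [e, e, ← Real.rpow_add (by norm_num), ← h2L]
      refine Real.rpow_le_rpow_of_exponent_le (by norm_num) ?_
      rw [hti]
      linarith
    rw [div_le_iff₀ hnR]
    have h5 : (0 : ℝ) < 4 ^ (t - 1) := by positivity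
    nlinarith
  have h2i : (2 : ℝ) ^ (L / 2) * (1 / 2) ^ (d + 3) ≤ 2 ^ (t - 1) := by
    rw [div_pow, one_pow, mul_one_div, ← Real.rpow_natCast, ← Real.rpow_natCast,
      ← Real.rpow_sub (by norm_num)]
    refine Real.rpow_le_rpow_of_exponent_le (by norm_num) ?_
    rw [hti]
    push_cast
    linarith
  set s : ℝ := (2 : ℝ) ^ (L / 2) with hs
  have hs0 : 0 < s := by positivity
  have hns : (n : ℝ) = s ^ 2 := by
    rw [hs, ← Real.rpow_natCast, ← Real.rpow_mul (by norm_num), ← h2L]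
    congr 1
    push_cast
    ring
  rw [rpow_neg_half hnR]
  calc (1 / 2) ^ (c + 1) * ((1 / 2) ^ (d + 3)) ^ c * (s ^ c)⁻¹
      = (1 / 2) ^ c * ((s * (1 / 2) ^ (d + 3)) ^ c * (1 / (n : ℝ) ^ c) * (1 / 2)) := by
        rw [hns]
        field_simp
        ring
    _ ≤ (1 / 2) ^ c * ((2 ^ (t - 1)) ^ c * (1 / (n : ℝ) ^ c) *
      (1 - ((t - 1 : ℕ) : ℝ) * (c * (K + 2) * (1 / 2) ^ K) - E * 4 ^ (t - 1) / n)) := by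
        gcongr
        linarith
    _ = _ := by rw [pow_right_comm 2 (t - 1) c]

/-! ### A fully independent instance of the family. -/

theorem ind_forall {ι : Type*} [Fintype ι] (p : ι → Prop) : ind (∀ i, p i) = ∏ i, ind (p i) := by
  by_cases h : ∀ i, p i
  · rw [ind_of h, Finset.prod_eq_one fun i _ => ind_of (h i)]
  · rw [ind_of_not h]
    push Not at h
    obtain ⟨i, hi⟩ := h
    exact (Finset.prod_eq_zero (Finset.mem_univ i) (ind_of_not hi)).symm

theorem sum_prod_eq_prod_sum {ι X : Type} [Fintype ι] [DecidableEq ι] [Fintype X]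
    (f : ι → X → ℝ) : ∑ z : ι → X, ∏ i, f i (z i) = ∏ i, ∑ x, f i x := by
  rw [Finset.prod_univ_sum, Fintype.piFinset_univ]

theorem uniform_toReal {Ω : Type} [Fintype Ω] [Nonempty Ω] (ω : Ω) :
    (PMF.uniformOfFintype Ω ω).toReal = 1 / Fintype.card Ω := by
  simp

section Independent

variable (n m t : ℕ) [NeZero n]

/-- Independent levels, with independent values within each level. -/
def indepLaw : PMF (Fin t → Fin m → Option (Fin n)) :=
  (PMF.uniformOfFintype (Fin t → Fin m → Bool × Fin n)).map fun ω i j =>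
    if (ω i j).1 then some (ω i j).2 else none

variable {n m t}

/-- The probability that a single value satisfies `B`. -/
def valueProb (B : Option (Fin n) → Prop) : ℝ :=
  (∑ x : Bool × Fin n, ind (B (if x.1 then some x.2 else none))) / (2 * n)

theorem valueProb_true : valueProb (n := n) (fun _ => True) = 1 := by
  have : (n : ℝ) ≠ 0 := Nat.cast_ne_zero.2 (NeZero.ne n)
  simp [valueProb, ind, this]

theorem pr_indepLaw (B : Fin t → Fin m → Option (Fin n) → Prop) :
    pr (indepLaw n m t) {h | ∀ i j, B i j (h i j)} = ∏ i, ∏ j, valueProb (B i j) := by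
  have hn : (n : ℝ) ≠ 0 := Nat.cast_ne_zero.2 (NeZero.ne n)
  rw [indepLaw, pr_map, pr_eq_sum]
  simp only [uniform_toReal]
  rw [← Finset.mul_sum]
  have h1 : ∀ ω : Fin t → Fin m → Bool × Fin n,
      ind (ω ∈ (fun (ω : Fin t → Fin m → Bool × Fin n) i j =>
        if (ω i j).1 then some (ω i j).2 else none) ⁻¹' {h | ∀ i j, B i j (h i j)}) =
      ∏ i, ∏ j, ind (B i j (if (ω i j).1 then some (ω i j).2 else none)) := by
    intro ω
    rw [← Finset.prod_congr rfl fun i _ => ind_forall _, ← ind_forall]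
    rfl
  rw [Finset.sum_congr rfl fun ω _ => h1 ω,
    sum_prod_eq_prod_sum fun (i : Fin t) (z : Fin m → Bool × Fin n) =>
      ∏ j, ind (B i j (if (z j).1 then some (z j).2 else none))]
  rw [Finset.prod_congr rfl fun i _ =>
    sum_prod_eq_prod_sum fun (j : Fin m) (x : Bool × Fin n) =>
      ind (B i j (if x.1 then some x.2 else none))]
  unfold valueProb
  simp only [Finset.prod_div_distrib, Finset.prod_const, Finset.card_univ, Fintype.card_fin,
    Fintype.card_fun, Fintype.card_prod, Fintype.card_bool]
  push_cast
  ring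

theorem pr_indepLaw_level (i : Fin t) (b : Fin m → Option (Fin n) → Prop) :
    pr (indepLaw n m t) {h | ∀ j, b j (h i j)} = ∏ j, valueProb (b j) := by
  have h1 := pr_indepLaw (n := n) fun (i' : Fin t) j v => i' = i → b j v
  have h2 : {h : Fin t → Fin m → Option (Fin n) | ∀ i' j, i' = i → b j (h i' j)} =
      {h | ∀ j, b j (h i j)} := by
    ext h
    exact ⟨fun hh j => hh i j rfl, fun hh i' j hi => hi ▸ hh j⟩
  rw [h2, Finset.prod_eq_single i] at h1
  · simpa using h1
  · intro i' _ hi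
    simp [hi, valueProb_true]
  · simp

theorem pr_indepLaw_value (i : Fin t) (j : Fin m) (b : Option (Fin n) → Prop) :
    pr (indepLaw n m t) {h | b (h i j)} = valueProb b := by
  have h1 := pr_indepLaw_level (n := n) i fun (j' : Fin m) v => j' = j → b v
  have h2 : {h : Fin t → Fin m → Option (Fin n) | ∀ j', j' = j → b (h i j')} =
      {h | b (h i j)} := by
    ext h
    exact ⟨fun hh => hh j rfl, fun hh j' hj => hj ▸ hh⟩
  rw [h2, Finset.prod_eq_single j] at h1
  · simpa using h1
  · intro j' _ hj
    simp [hj, valueProb_true]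
  · simp

theorem isLevelLaw_indepLaw (κ : ℕ) : IsLevelLaw n m t κ (indepLaw n m t) where
  indep g := by
    have h1 := pr_indepLaw fun (i : Fin t) (j : Fin m) v => v = g i j
    have h2 := fun i : Fin t => pr_indepLaw_level i fun (j : Fin m) v => v = g i j
    simp only [funext_iff]
    rw [h1, Finset.prod_congr rfl fun i _ => (h2 i).symm]
  marginal_zero i j := by
    have hn : (n : ℝ) ≠ 0 := Nat.cast_ne_zero.2 (NeZero.ne n)
    rw [pr_indepLaw_value i j fun v => v = none, valueProb, Fintype.sum_prod_type]
    simp [ind]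
    field_simp
  marginal_vertex i j v := by
    have hn : (n : ℝ) ≠ 0 := Nat.cast_ne_zero.2 (NeZero.ne n)
    rw [pr_indepLaw_value i j fun w => w = some v, valueProb, Fintype.sum_prod_type]
    simp [ind, Finset.filter_eq']
  kwise i s _ y := by
    classical
    have h1 := pr_indepLaw_level (n := n) i fun (j : Fin m) v => j ∈ s → v = y j
    rw [h1, ← Finset.prod_subset (Finset.subset_univ s)]
    · refine Finset.prod_congr rfl fun j hj => ?_
      rw [pr_indepLaw_value i j fun v => v = y j]
      simp [hj]
    · intro j _ hj
      simp [hj, valueProb_true]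

end Independent

/-! ### Sampling with a union bound. -/

section Sampling

/-- A convex function lies below its chord on `[0, 1]`. -/
theorem half_rpow_le {x : ℝ} (h0 : 0 ≤ x) (h1 : x ≤ 1) : (1 / 2 : ℝ) ^ x ≤ 1 - x / 2 := by
  have := rpow_one_add_le_one_add_mul_self (s := (-1 / 2 : ℝ)) (by norm_num) h0 h1
  norm_num at this ⊢
  linarith

/-- Some sample has averages that are not much smaller than the expectations, for all of the
random variables `X θ` simultaneously. -/
theorem exists_sample {Ω Θ R : Type} [Fintype Ω] [Nonempty Ω] [Fintype Θ] [Fintype R]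
    [DecidableEq R] (P : Θ → Prop) (X : Θ → Ω → ℝ) (hX0 : ∀ θ ω, 0 ≤ X θ ω)
    (hX1 : ∀ θ ω, X θ ω ≤ 1) {p : ℝ} (hp : ∀ θ, P θ → p ≤ (∑ ω, X θ ω) / (Fintype.card Ω : ℝ))
    (hR : (Fintype.card Θ : ℝ) ≤ Real.exp (p * Fintype.card R / 4)) (hp0 : 0 < p) :
    ∃ z : R → Ω, ∀ θ, P θ → p * Fintype.card R / 4 ≤ ∑ s, X θ (z s) := by
  by_contra! hcon
  set N : ℝ := (Fintype.card Ω : ℝ) with hN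
  set S : ℝ := p * Fintype.card R / 4 with hS
  have hN0 : 0 < N := by rw [hN]; exact_mod_cast Fintype.card_pos
  -- Lower-tail Chernoff bound: if every sample failed some test, the sum of the moments of
  -- `(1/2)^(∑ X)` would exceed what `hup` allows.
  have hlow : ∀ z : R → Ω, (1 / 2 : ℝ) ^ S <
      ∑ θ, ind (P θ) * ∏ s, (1 / 2 : ℝ) ^ X θ (z s) := by
    intro z
    obtain ⟨θ, hθ, hlt⟩ := hcon z
    have h1 : (1 / 2 : ℝ) ^ S < ind (P θ) * ∏ s, (1 / 2 : ℝ) ^ X θ (z s) := by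
      rw [ind_of hθ, one_mul, ← Real.rpow_sum_of_pos (by norm_num)]
      exact Real.rpow_lt_rpow_of_exponent_gt (by norm_num) (by norm_num) hlt
    exact h1.trans_le (Finset.single_le_sum
      (f := fun θ => ind (P θ) * ∏ s, (1 / 2 : ℝ) ^ X θ (z s))
      (fun θ _ => mul_nonneg (ind_nonneg _) (Finset.prod_nonneg fun _ _ => by positivity))
      (Finset.mem_univ θ))
  have hup : ∀ θ, ∑ z : R → Ω, ind (P θ) * ∏ s, (1 / 2 : ℝ) ^ X θ (z s) ≤
      (N * Real.exp (-p / 2)) ^ Fintype.card R := by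
    intro θ
    rw [← Finset.mul_sum, sum_prod_eq_prod_sum fun (_ : R) ω => (1 / 2 : ℝ) ^ X θ ω,
      Finset.prod_const, Finset.card_univ]
    by_cases hθ : P θ
    · rw [ind_of hθ, one_mul]
      refine pow_le_pow_left₀ (Finset.sum_nonneg fun _ _ => by positivity) ?_ _
      have h1 := hp θ hθ
      rw [le_div_iff₀ hN0] at h1
      have h2 := Real.add_one_le_exp (-p / 2)
      calc ∑ ω, (1 / 2 : ℝ) ^ X θ ω ≤ ∑ ω, (1 - X θ ω / 2) :=
            Finset.sum_le_sum fun ω _ => half_rpow_le (hX0 θ ω) (hX1 θ ω)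
        _ = N - (∑ ω, X θ ω) / 2 := by
            rw [Finset.sum_sub_distrib, Finset.sum_div]
            simp [hN]
        _ ≤ N * (-p / 2 + 1) := by linarith
        _ ≤ _ := by gcongr
    · rw [ind_of_not hθ, zero_mul]
      positivity
  have hsum := Finset.sum_lt_sum_of_nonempty (Finset.univ_nonempty (α := R → Ω))
    fun z _ => hlow z
  rw [Finset.sum_comm] at hsum
  have h3 := hsum.trans_le (Finset.sum_le_sum fun θ _ => hup θ)
  rw [Finset.sum_const, Finset.sum_const, nsmul_eq_mul, nsmul_eq_mul, Finset.card_univ,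
    Finset.card_univ, Fintype.card_fun, Nat.cast_pow, ← hN, mul_pow, ← Real.exp_nat_mul,
    mul_left_comm] at h3
  have h4 := lt_of_mul_lt_mul_left h3 (by positivity)
  have h5 : Real.exp (-S) ≤ (1 / 2 : ℝ) ^ S := by
    rw [Real.rpow_def_of_pos (by norm_num)]
    apply Real.exp_le_exp.2
    have h6 : -1 ≤ Real.log (1 / 2) := by
      have h7 := Real.log_two_lt_d9
      rw [one_div, Real.log_inv]
      linarith
    have h8 : 0 ≤ S := by positivity
    nlinarith
  have h6 : (Fintype.card Θ : ℝ) * Real.exp (Fintype.card R * (-p / 2)) ≤ Real.exp (-S) := by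
    refine (mul_le_mul_of_nonneg_right hR (Real.exp_pos _).le).trans_eq ?_
    rw [← Real.exp_add]
    congr 1
    rw [hS]
    ring
  linarith

end Sampling

/-! ### Short seeds for total hashes. -/

variable {n m c : ℕ}

/-- The fraction of the vertices from which all `u i` are reachable. -/
def hitFraction (a : Fin n → Fin m) (u : Fin c → Fin n) (h : Fin m → Option (Fin n)) : ℝ :=
  (∑ x, ind (∀ i, u i ∈ outSet a h x)) / n

theorem hitFraction_nonneg (a : Fin n → Fin m) (u : Fin c → Fin n)
    (h : Fin m → Option (Fin n)) : 0 ≤ hitFraction a u h :=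
  div_nonneg (Finset.sum_nonneg fun _ _ => ind_nonneg _) (Nat.cast_nonneg _)

theorem hitFraction_le_one (a : Fin n → Fin m) (u : Fin c → Fin n)
    (h : Fin m → Option (Fin n)) : hitFraction a u h ≤ 1 := by
  refine div_le_one_of_le₀ ?_ (Nat.cast_nonneg _)
  refine (Finset.sum_le_sum fun x _ => ind_le_one _).trans ?_
  simp

theorem hitFraction_mono {a : Fin n → Fin m} {u : Fin c → Fin n}
    {h h' : Fin m → Option (Fin n)} (hh : ∀ j w, h j = some w → h' j = some w) :
    hitFraction a u h ≤ hitFraction a u h' :=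
  div_le_div_of_nonneg_right (Finset.sum_le_sum fun x _ => ind_mono fun hu i =>
    outSet_mono (fun v w => hh (a v) w) x (hu i)) (Nat.cast_nonneg _)

theorem reachProb_uniform {Ω : Type} [Fintype Ω] [Nonempty Ω] (h : Ω → Fin m → Option (Fin n))
    (a : Fin n → Fin m) (u : Fin c → Fin n) :
    reachProb ((PMF.uniformOfFintype Ω).map h) a u =
      (∑ ω, hitFraction a u (h ω)) / (Fintype.card Ω : ℝ) := by
  rw [reachProb_eq_sum, Finset.sum_div]
  refine Finset.sum_congr rfl fun ω _ => ?_
  rw [uniform_toReal, one_div_mul_eq_div]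
  rfl

/-- A uniform choice from a finite connecting family of total hashes can be replaced by a choice
with few random bits. -/
theorem exists_seedFamily (hn : 2 ≤ n) (hnm : n ≤ m) {δ : ℝ} (hδ : 0 < δ) (hδ1 : δ ≤ 1)
    {Ω : Type} [Fintype Ω] [Nonempty Ω] (F : Ω → Fin m → Fin n)
    (hF : IsConnecting c δ ((PMF.uniformOfFintype Ω).map fun ω j => some (F ω j))) :
    ∃ r : ℕ, (r : ℝ) ≤ (5 + 2 * c + Real.logb 2 (1 / δ)) * Real.logb 2 n ^ 2 * Real.logb 2 m ∧
      ∃ G : (Fin r → Bool) → Fin m → Fin n, IsConnecting c (δ / 4) (seedFamily G) := by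
  have hnR : (2 : ℝ) ≤ n := by exact_mod_cast hn
  have hmR : (n : ℝ) ≤ m := by exact_mod_cast hnm
  set L := Real.logb 2 n with hL
  set M := Real.logb 2 m with hM
  set e := Real.logb 2 (1 / δ) with he
  have h2L : (2 : ℝ) ^ L = n := Real.rpow_logb (by norm_num) (by norm_num) (by linarith)
  have h2M : (2 : ℝ) ^ M = m := Real.rpow_logb (by norm_num) (by norm_num) (by linarith)
  have h2e : (2 : ℝ) ^ e = 1 / δ := Real.rpow_logb (by norm_num) (by norm_num) (by positivity)
  have hL1 : 1 ≤ L := by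
    rw [hL, Real.le_logb_iff_rpow_le (by norm_num) (by linarith), Real.rpow_one]
    exact hnR
  have hM1 : 1 ≤ M := by
    rw [hM, Real.le_logb_iff_rpow_le (by norm_num) (by linarith), Real.rpow_one]
    linarith
  have he0 : 0 ≤ e := Real.logb_nonneg (by norm_num) (by rw [le_div_iff₀ hδ]; linarith)
  have hc0 : (0 : ℝ) ≤ c := Nat.cast_nonneg c
  -- Chosen so that `p 2^B / 4 = n 2^c m`, which dominates the logarithm of the number `m^n n^c` of
  -- tests.
  set B := 2 + L + c + M + L / 2 * c + e with hB
  have hB0 : 0 ≤ B := by positivity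
  have h2B : (2 : ℝ) ^ B = 4 * n * 2 ^ c * m * ((2 : ℝ) ^ (L / 2)) ^ c * (1 / δ) := by
    rw [hB, Real.rpow_add (by norm_num), Real.rpow_add (by norm_num), Real.rpow_add (by norm_num),
      Real.rpow_add (by norm_num), Real.rpow_add (by norm_num), h2L, h2M, h2e,
      Real.rpow_mul (by norm_num), Real.rpow_natCast, Real.rpow_natCast]
    norm_num
  refine ⟨⌈B⌉₊, ?_, ?_⟩
  · have h1 := (Nat.ceil_lt_add_one hB0).le
    have hT : 1 ≤ L ^ 2 * M := one_le_mul_of_one_le_of_one_le (one_le_pow₀ hL1) hM1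
    have hLT : L ≤ L ^ 2 * M := by nlinarith
    have hMT : M ≤ L ^ 2 * M := le_mul_of_one_le_left (by linarith) (one_le_pow₀ hL1)
    have h2 : c * L ≤ c * (L ^ 2 * M) := by gcongr
    have h3 : (c : ℝ) ≤ c * (L ^ 2 * M) := le_mul_of_one_le_right hc0 hT
    have h4 : e ≤ e * (L ^ 2 * M) := le_mul_of_one_le_right he0 hT
    rw [mul_assoc]
    linarith
  · set r := ⌈B⌉₊
    have hr : (2 : ℝ) ^ B ≤ 2 ^ r := by
      rw [← Real.rpow_natCast]
      exact Real.rpow_le_rpow_of_exponent_le (by norm_num) (Nat.le_ceil B)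
    set p := δ * (n : ℝ) ^ (-(c : ℝ) / 2) with hp
    have hp0 : 0 < p := by
      have : (0 : ℝ) < n := by linarith
      positivity
    have hcardR : (Fintype.card (Fin r → Bool) : ℝ) = 2 ^ r := by simp
    have hpr : (n : ℝ) * 2 ^ c * m ≤ p * 2 ^ r / 4 := by
      have h1 : p * 2 ^ B / 4 = n * 2 ^ c * m := by
        rw [h2B, hp, rpow_neg_half (by linarith), ← hL]
        field_simp
      rw [← h1]
      gcongr
    have hR : (Fintype.card ((Fin n → Fin m) × (Fin c → Fin n)) : ℝ) ≤
        Real.exp (p * Fintype.card (Fin r → Bool) / 4) := by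
      rw [hcardR]
      refine le_trans ?_ (Real.exp_le_exp.2 hpr)
      have hm0 : (0 : ℝ) < m := by linarith
      have h1 : (m : ℝ) ≤ Real.exp m := by linarith [Real.add_one_le_exp (m : ℝ)]
      have h2 : (c : ℝ) + 1 ≤ 2 ^ c := by exact_mod_cast Nat.lt_two_pow_self (n := c)
      simp only [Fintype.card_prod, Fintype.card_fun, Fintype.card_fin]
      push_cast
      calc (m : ℝ) ^ n * n ^ c ≤ m ^ n * m ^ c := by gcongr
        _ = m ^ (n + c) := (pow_add _ _ _).symm
        _ ≤ Real.exp m ^ (n + c) := by gcongr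
        _ = Real.exp ((n + c) * m) := by rw [← Real.exp_nat_mul]; push_cast; rfl
        _ ≤ _ := by
            apply Real.exp_le_exp.2
            gcongr
            nlinarith
    obtain ⟨z, hz⟩ := exists_sample (Ω := Ω) (R := Fin r → Bool)
      (fun θ : (Fin n → Fin m) × (Fin c → Fin n) => Injective θ.1 ∧ StrictMono θ.2)
      (fun θ ω => hitFraction θ.1 θ.2 fun j => some (F ω j))
      (fun _ _ => hitFraction_nonneg _ _ _) (fun _ _ => hitFraction_le_one _ _ _)
      (fun θ hθ => (hF θ.1 hθ.1 θ.2 hθ.2).trans_eq (reachProb_uniform _ _ _)) hR hp0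
    refine ⟨fun s => F (z s), fun a ha u hu => ?_⟩
    have h1 := hz (a, u) ⟨ha, hu⟩
    rw [seedFamily, reachProb_uniform, le_div_iff₀ (by positivity)]
    refine le_trans (le_of_eq ?_) h1
    ring

/-- Uniform random functions connect any `c` vertices with probability at least `n ^ (-c)`. -/
theorem reachProb_uniform_functions (hn : 0 < n) (hc : 1 ≤ c) {a : Fin n → Fin m}
    (ha : Injective a) {u : Fin c → Fin n} (hu : Injective u) [Nonempty (Fin m → Fin n)] :
    1 / (n : ℝ) ^ c ≤ reachProb ((PMF.uniformOfFintype (Fin m → Fin n)).map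
      fun f j => some (f j)) a u := by
  obtain ⟨d, rfl⟩ : ∃ d, c = d + 1 := ⟨c - 1, by omega⟩
  have : Nonempty (Fin n) := ⟨⟨0, hn⟩⟩
  rw [reachProb_uniform]
  -- The path through `u 0, …, u d` prescribes `d = c - 1` hash values, and the start equals `u 0`
  -- with probability `1/n`.
  have hpt : ∀ f : Fin m → Fin n, ind ((fun i : Fin d => u i.succ) =
      f ∘ fun i : Fin d => a (u i.castSucc)) * (1 / n) ≤
        hitFraction a u fun j => some (f j) := by
    intro f
    by_cases hf : (fun i : Fin d => u i.succ) = f ∘ fun i : Fin d => a (u i.castSucc)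
    · rw [ind_of hf, one_mul, hitFraction]
      refine div_le_div_of_nonneg_right ?_ (Nat.cast_nonneg _)
      have hall : ∀ i, u i ∈ outSet a (fun j => some (f j)) (u 0) := by
        intro i
        induction i using Fin.induction with
        | zero => exact Relation.ReflTransGen.refl
        | succ i ih => exact Relation.ReflTransGen.tail ih (congrArg some (congrFun hf i).symm)
      rw [← ind_of hall]
      exact Finset.single_le_sum
        (f := fun x => ind (∀ i, u i ∈ outSet a (fun j => some (f j)) x))
        (fun _ _ => ind_nonneg _) (Finset.mem_univ (u 0))
    · rw [ind_of_not hf, zero_mul]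
      exact hitFraction_nonneg _ _ _
  have hinj : Injective fun i : Fin d => a (u i.castSucc) :=
    ha.comp (hu.comp (Fin.castSucc_injective d))
  have h1 := avg_comp (V := Fin n) _ hinj fun z => ind ((fun i : Fin d => u i.succ) = z)
  rw [avg_ind_eq, avg, Fintype.card_fin, Fintype.card_fin, Fintype.card_fin] at h1
  rw [pow_succ, ← one_div_mul_one_div, ← h1, div_mul_eq_mul_div, Finset.sum_mul,
    Fintype.card_fun, Fintype.card_fin, Fintype.card_fin, Nat.cast_pow]
  gcongr with f
  exact hpt f

theorem exists_seedFamily_isConnecting (c : ℕ) (hc : 1 ≤ c) :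
    ∃ C : ℝ, 0 < C ∧ ∃ δ : ℝ, 0 < δ ∧ ∀ n m : ℕ, 2 ≤ n → n ≤ m →
      ∃ r : ℕ, (r : ℝ) ≤ C * Real.logb 2 n ^ 2 * Real.logb 2 m ∧
        ∃ G : (Fin r → Bool) → Fin m → Fin n, IsConnecting c δ (seedFamily G) := by
  obtain ⟨D, hD, δ₁, hδ₁, n₀, h⟩ := exists_isConnecting_finalLaw c hc
  obtain ⟨n₁, hn₁⟩ := Filter.eventually_atTop.1 (eventually_le_logb (2 * D))
  set N : ℕ := max n₀ n₁ + 1 with hN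
  have hN0 : (0 : ℝ) < N := by rw [hN]; positivity
  set δ : ℝ := min (min δ₁ (1 / (N : ℝ) ^ c)) 1 with hδ
  have hδ0 : 0 < δ := by positivity
  have hδ1 : δ ≤ 1 := min_le_right _ _
  have he0 : 0 ≤ Real.logb 2 (1 / δ) :=
    Real.logb_nonneg (by norm_num) (by rw [le_div_iff₀ hδ0]; linarith)
  refine ⟨5 + 2 * c + Real.logb 2 (1 / δ), by positivity, δ / 4, by positivity,
    fun n m hn hnm => ?_⟩
  have : NeZero n := ⟨by omega⟩
  have hn0 : (0 : ℝ) < n := by exact_mod_cast (by omega : 0 < n)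
  -- Below the threshold `N`, uniform functions give `n^(-c) ≥ N^(-c)`, which is a constant.
  rcases lt_or_ge n N with hlt | hge
  · refine exists_seedFamily hn hnm hδ0 hδ1 (Ω := Fin m → Fin n) id fun a ha u hu => ?_
    refine le_trans ?_ (reachProb_uniform_functions (by omega) hc ha hu.injective)
    have h1 : (n : ℝ) ^ (-(c : ℝ) / 2) ≤ 1 :=
      Real.rpow_le_one_of_one_le_of_nonpos (by exact_mod_cast (by omega : 1 ≤ n))
        (by have : (0 : ℝ) ≤ c := Nat.cast_nonneg c; linarith)
    have h2 : δ ≤ 1 / (N : ℝ) ^ c := (min_le_left _ _).trans (min_le_right _ _)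
    have h3 : (1 : ℝ) / (N : ℝ) ^ c ≤ 1 / (n : ℝ) ^ c := by gcongr
    calc δ * (n : ℝ) ^ (-(c : ℝ) / 2) ≤ δ * 1 := by gcongr
      _ ≤ _ := by linarith
  · have hL := hn₁ n (by omega)
    set L := Real.logb 2 n with hLdef
    have hc0 : (0 : ℝ) ≤ c := Nat.cast_nonneg c
    have hfl : ∀ x : ℝ, 0 ≤ x → |((⌊x⌋₊ : ℕ) : ℝ) - x| < 1 := by
      intro x hx
      have h1 := Nat.floor_le hx
      have h2 := Nat.lt_floor_add_one x
      rw [abs_lt]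
      constructor <;> linarith
    set t := ⌊1 / 2 * L - D⌋₊
    have hcon := h n m t ⌊5 * c * L⌋₊ (by omega) hnm (hfl _ (by linarith))
      (hfl _ (by have : 0 ≤ L := by linarith
                 positivity)) _ (isLevelLaw_indepLaw _)
    -- An undefined value is replaced by the vertex `0`, which only adds edges.
    let F : (Fin t → Fin m → Bool × Fin n) → Fin m → Fin n := fun ω j =>
      (finalHash (fun i j => if (ω i j).1 then some (ω i j).2 else none) j).getD 0
    refine exists_seedFamily hn hnm hδ0 hδ1 F fun a ha u hu => ?_
    have h1 := hcon a ha u hu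
    rw [finalLaw, indepLaw, PMF.map_comp, reachProb_uniform] at h1
    rw [reachProb_uniform]
    have h2 : δ ≤ δ₁ := (min_le_left _ _).trans (min_le_left _ _)
    refine le_trans (le_trans ?_ h1) ?_
    · gcongr
    · gcongr with ω
      refine hitFraction_mono fun j w hw => ?_
      simp only [comp_apply] at hw
      simp [F, hw]

end Connecting

end

theorem mainTheorem6 (c : ℕ) (hc : 1 ≤ c) :
    (∃ D : ℝ, 1 ≤ D ∧ ∃ δ : ℝ, 0 < δ ∧ ∃ n₀ : ℕ, ∀ n m t κ : ℕ, n₀ ≤ n → n ≤ m →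
      |(t : ℝ) - (1 / 2 * Real.logb 2 n - D)| < 1 →
      |(κ : ℝ) - 5 * c * Real.logb 2 n| < 1 →
      ∀ Q : PMF (Fin t → Fin m → Option (Fin n)), IsLevelLaw n m t κ Q →
        IsConnecting c δ (finalLaw Q)) ∧
    (∃ C : ℝ, 0 < C ∧ ∃ δ : ℝ, 0 < δ ∧ ∀ n m : ℕ, 2 ≤ n → n ≤ m →
      ∃ r : ℕ, (r : ℝ) ≤ C * Real.logb 2 n ^ 2 * Real.logb 2 m ∧
        ∃ G : (Fin r → Bool) → Fin m → Fin n, IsConnecting c δ (seedFamily G)) :=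
  ⟨Connecting.exists_isConnecting_finalLaw c hc, Connecting.exists_seedFamily_isConnecting c hc⟩
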